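/- A (string-based) multiway system $M=(R,s_{\mathrm{init}},\Sigma)$ consists of a finite alphabet $\Sigma$, a finite set $R$ of string replacement rules $r\to t$ with $r,t\in\Sigma^*$, and an initial string $s_{\mathrm{init}}\in\Sigma^*$. Its states graph has an edge from $u$ to $v$ if $v$ arises from $u$ by replacing one occurrence of the left-hand side of a rule by its right-hand side. The growth function $g_M(n)$ is the number of strings to which the shortest directed path from $s_{\mathrm{init}}$ in the states graph has length $n$. For a sequence $(a(n))_{n\ge 1}$ of real numbers, let $L(a)$ be its linear interpolation, the function on $\mathbb{R}_{\ge 0}$ whose graph is the polygonal chain starting at $(0,0)$ and passing through the points $(n,a(n))$, $n=1,2,3,\dots$. For real functions $u,v$ on $\mathbb{R}_{\ge 0}$ write $u\sim_\Theta v$ if there are constants $C_1,C_2,x_0>0$ with $C_1|v(x)|\le |u(x)|\le C_2|v(x)|$ for all $x>x_0$. A function $f:\mathbb{R}_{\ge 0}\to\mathbb{R}_{\ge 0}$ is called multiway-growth-approximable if there is a multiway system $M$ with $f\sim_\Theta L(g_M)$. The discrete convolution of $u$ and $v$ is given at positive integers by $(u*v)(n)=\sum_{k=0}^{n}u(k)\,v(n-k)$,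 where $u(0)$ and $v(0)$ are replaced by $1$, and is extended to $\mathbb{R}_{\ge 0}$ by the linear interpolation $L$. Let $f:\mathbb{R}_{\ge 0}\to\mathbb{R}_{\ge 0}$ be a function for which there is a function $g\sim_\Theta f$ that can be built in finitely many steps, using pointwise addition and discrete convolution, from the functions $x\mapsto c$, $x\mapsto x^n$, $x\mapsto a^x$, $x\mapsto a^{\sqrt{x}}$, $x\mapsto\sqrt{x}$ and $x\mapsto\ln(x)$, with arbitrary positive integers $a,c,n$. Then $f$ is multiway-growth-approximable. -/

import Mathlib

open Filter Asymptotics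
open scoped NNReal

/-- A string-based multiway system `(R, s_init, Σ)`: a finite alphabet, a finite set of string
replacement rules `r → t` (stored as pairs `(r, t)` of words), and an initial word. -/
structure MultiwaySystem where
  /-- the alphabet `Σ` -/
  Alphabet : Type
  /-- the alphabet is finite -/
  finite_alphabet : Finite Alphabet
  /-- the replacement rules `R` -/
  rules : Finset (List Alphabet × List Alphabet)
  /-- the initial string -/
  init : List Alphabet

namespace MultiwaySystem

/-- The edges of the states graph: `v` arises from `u` by replacing one occurrence, at an arbitrary
position, of the left-hand side of a rule by its right-hand side. -/
def Step (M : MultiwaySystem) (u v : List M.Alphabet) : Prop :=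
  ∃ r ∈ M.rules, ∃ x y : List M.Alphabet, u = x ++ r.1 ++ y ∧ v = x ++ r.2 ++ y

/-- The endpoints of the paths of length exactly `n` that start at the initial string. -/
def pathEnds (M : MultiwaySystem) : ℕ → Set (List M.Alphabet)
  | 0 => {M.init}
  | n + 1 => {v | ∃ u ∈ M.pathEnds n, M.Step u v}

/-- The state-set of generation `n`: the states to which the shortest path from the initial string
has length `n`. -/
def stateSet (M : MultiwaySystem) (n : ℕ) : Set (List M.Alphabet) :=
  {v | v ∈ M.pathEnds n ∧ ∀ m < n, v ∉ M.pathEnds m}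

/-- The growth function `g_M`: the number of states in generation `n`. -/
noncomputable def growth (M : MultiwaySystem) (n : ℕ) : ℕ :=
  (M.stateSet n).ncard

theorem pathEnds_finite (M : MultiwaySystem) (n : ℕ) : (M.pathEnds n).Finite := by
  induction n with
  | zero => exact Set.finite_singleton _
  | succ n ih =>
    have key : ∀ u : List M.Alphabet, {v | M.Step u v}.Finite := by
      intro u
      have hsub : {v | M.Step u v} ⊆ ⋃ r ∈ (M.rules : Set (List M.Alphabet × List M.Alphabet)),
          (fun p : ℕ × ℕ => u.take p.1 ++ r.2 ++ u.drop p.2) ''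
            (Set.Iic u.length ×ˢ Set.Iic u.length) := by
        rintro v ⟨r, hr, x, y, hu, hv⟩
        refine Set.mem_biUnion (Finset.mem_coe.2 hr)
          ⟨(x.length, (x ++ r.1).length), ⟨?_, ?_⟩, ?_⟩
        · simp [hu]
        · simp [hu]
        · have h1 : u.take x.length = x := by
            rw [hu, List.append_assoc]; exact List.take_left
          have h2 : u.drop (x ++ r.1).length = y := by
            rw [hu]; exact List.drop_left
          simp only [h1, h2, hv]
      exact (M.rules.finite_toSet.biUnion fun r _ =>
        ((Set.finite_Iic _).prod (Set.finite_Iic _)).image _).subset hsub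
    have : M.pathEnds (n + 1) = ⋃ u ∈ M.pathEnds n, {v | M.Step u v} := by
      ext v; simp [pathEnds]
    rw [this]
    exact ih.biUnion fun u _ => key u

/-- Every generation is finite, so `growth` is a genuine cardinality. -/
theorem stateSet_finite (M : MultiwaySystem) (n : ℕ) : (M.stateSet n).Finite :=
  (M.pathEnds_finite n).subset fun _ h => h.1

end MultiwaySystem

/-- The linear interpolation over the positive integers of a sequence `a`: the polygonal chain
through `(0, 0)` and all points `(n, a n)`, `n ≥ 1`. The value `a 0` is not used. -/
noncomputable def linearInterpolation (a : ℕ → ℝ) (x : ℝ≥0) : ℝ :=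
  let b : ℕ → ℝ := fun n => if n = 0 then 0 else a n
  b ⌊x⌋₊ + ((x : ℝ) - (⌊x⌋₊ : ℝ)) * (b (⌊x⌋₊ + 1) - b ⌊x⌋₊)

/-- `f : ℝ≥0 → ℝ≥0` is multiway-growth-approximable if it is `Θ`-equivalent to the linear
interpolation of the growth function of some multiway system. -/
def MultiwayGrowthApproximable (f : ℝ≥0 → ℝ≥0) : Prop :=
  ∃ M : MultiwaySystem,
    (fun x => (f x : ℝ)) =Θ[atTop] linearInterpolation (fun n => (M.growth n : ℝ))

/-- The sequence of the values of `u` at the positive integers, with value `1` at the index `0`. -/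
noncomputable def unitAtZero (u : ℝ≥0 → ℝ) (k : ℕ) : ℝ :=
  if k = 0 then 1 else u (k : ℝ≥0)

/-- The discrete convolution `(u * v)(n) = ∑_{k=0}^n u(k) v(n-k)` with the convention
`u(0) = v(0) = 1`, regarded as a function on `ℝ≥0` by linear interpolation. -/
noncomputable def discreteConvolution (u v : ℝ≥0 → ℝ) : ℝ≥0 → ℝ :=
  linearInterpolation fun n =>
    ∑ k ∈ Finset.range (n + 1), unitAtZero u k * unitAtZero v (n - k)

/-- The finite combinations of the basic functions by pointwise addition and discrete
convolution. (The values are taken in `ℝ` because `ln` is negative on `(0, 1)`; only the behaviour at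
infinity and, in convolutions, the values at positive integers matter.) -/
inductive IsFiniteCombination : (ℝ≥0 → ℝ) → Prop
  | const (c : ℕ) (hc : 1 ≤ c) : IsFiniteCombination fun _ => (c : ℝ)
  | power (n : ℕ) (hn : 1 ≤ n) : IsFiniteCombination fun x => (x : ℝ) ^ n
  | exponential (a : ℕ) (ha : 1 ≤ a) : IsFiniteCombination fun x => (a : ℝ) ^ (x : ℝ)
  | exponentialSqrt (a : ℕ) (ha : 1 ≤ a) : IsFiniteCombination fun x => (a : ℝ) ^ Real.sqrt (x : ℝ)
  | squareRoot : IsFiniteCombination fun x => Real.sqrt (x : ℝ)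
  | logarithm : IsFiniteCombination fun x => Real.log (x : ℝ)
  | add {u v : ℝ≥0 → ℝ} (hu : IsFiniteCombination u) (hv : IsFiniteCombination v) :
      IsFiniteCombination fun x => u x + v x
  | convolution {u v : ℝ≥0 → ℝ} (hu : IsFiniteCombination u) (hv : IsFiniteCombination v) :
      IsFiniteCombination (discreteConvolution u v)

/-! Up to bounded factors, growth functions are closed under convolution and addition, and every
basic function is the growth of an explicit system.

Convolution: run two systems side by side on disjoint alphabets. The reachable words are
juxtapositions, distances from the start add, and the spheres therefore convolve
(`IsGrowth.convolution`). This needs every left-hand side to be nonempty, since an insertion rule of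
one system could act inside the word of the other; hence `IsProper` is part of `IsGrowth`. Addition:
a first step chooses one of two systems, which gives the sum delayed by one generation
(`IsGrowth.add`).

Basic functions: a head sweeps over a tape and back, and each return to the left end is a tick. At a
tick the word gains one letter, chosen along a relation `E`; otherwise the rewriting is
deterministic. Old letters are kept, so different walks never merge, and no word recurs at a later
time because its history and head position determine the time. Hence `g n` is the number of
`E`-walks whose length is the number of ticks before time `n` (`isGrowth_walkClock`). An empty tape,
a tape growing by one cell per sweep and a doubling tape give about `n / 2`, `√n` and `log₂ n`
ticks; complete graphs give `a ^ k` walks and a two-vertex graph gives `k + 1`. Constants come from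
scaling `1`, and powers from repeated convolution with `1`.

The induction over combinations carries `IsGrowthLike`, which includes tameness: consecutive values
of the growth function are comparable. Tameness absorbs the delay in sums, the passage between
integer parts and linear interpolation, and the one place where a basic function vanishes at a
positive integer, `log 1 = 0`. -/

namespace StringRewriting

/-! ### Rewriting systems, spheres and growth functions -/

/-- One application of a rule of `R` at an arbitrary position. -/
def Rewrites {α : Type*} (R : Set (List α × List α)) (u v : List α) : Prop :=
  ∃ r ∈ R, ∃ x y : List α, u = x ++ r.1 ++ y ∧ v = x ++ r.2 ++ y

/-- The words that are reached from `s` by exactly `n` rule applications. -/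
def reach {α : Type*} (R : Set (List α × List α)) (s : List α) : ℕ → Set (List α)
  | 0 => {s}
  | n + 1 => {v | ∃ u ∈ reach R s n, Rewrites R u v}

/-- The words whose distance from `s` is `n`. -/
def sphere {α : Type*} (R : Set (List α × List α)) (s : List α) (n : ℕ) : Set (List α) :=
  {v | v ∈ reach R s n ∧ ∀ m < n, v ∉ reach R s m}

/-- No rule has an empty left-hand side. -/
def IsProper {α : Type*} (R : Set (List α × List α)) : Prop :=
  ∀ r ∈ R, r.1 ≠ []

/-- The multiway system with a given finite set of rules. -/
noncomputable def toSystem {α : Type} [Finite α] {R : Set (List α × List α)} (hR : R.Finite)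
    (s : List α) : MultiwaySystem where
  Alphabet := α
  finite_alphabet := inferInstance
  rules := hR.toFinset
  init := s

theorem toSystem_pathEnds {α : Type} [Finite α] {R : Set (List α × List α)} (hR : R.Finite)
    (s : List α) (n : ℕ) : (toSystem hR s).pathEnds n = reach R s n := by
  have hstep : ∀ u v : List α, (toSystem hR s).Step u v ↔ Rewrites R u v := by
    intro u v
    constructor
    · rintro ⟨r, hr, h⟩
      exact ⟨r, hR.mem_toFinset.1 hr, h⟩
    · rintro ⟨r, hr, h⟩
      exact ⟨r, hR.mem_toFinset.2 hr, h⟩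
  induction n with
  | zero => rfl
  | succ n ih =>
    change {v : List α | ∃ u ∈ (toSystem hR s).pathEnds n, (toSystem hR s).Step u v} = _
    rw [ih]
    ext v
    exact exists_congr fun u => and_congr_right fun _ => hstep u v

theorem toSystem_stateSet {α : Type} [Finite α] {R : Set (List α × List α)} (hR : R.Finite)
    (s : List α) (n : ℕ) : (toSystem hR s).stateSet n = sphere R s n := by
  change {v : List α | v ∈ (toSystem hR s).pathEnds n ∧
    ∀ m < n, v ∉ (toSystem hR s).pathEnds m} = _
  rw [funext (toSystem_pathEnds hR s)]
  rfl

/-- `g` is the growth function of a system without empty left-hand sides. -/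
def IsGrowth (g : ℕ → ℕ) : Prop :=
  ∃ (α : Type) (_ : Finite α) (R : Set (List α × List α)) (s : List α),
    R.Finite ∧ IsProper R ∧ ∀ n, (sphere R s n).ncard = g n

theorem IsGrowth.exists_system {g : ℕ → ℕ} (h : IsGrowth g) :
    ∃ M : MultiwaySystem, ∀ n, M.growth n = g n := by
  obtain ⟨α, _, R, s, hR, -, hg⟩ := h
  refine ⟨toSystem hR s, fun n => ?_⟩
  rw [MultiwaySystem.growth, toSystem_stateSet hR s n]
  exact hg n

theorem sphere_finite {α : Type} [Finite α] {R : Set (List α × List α)} (hR : R.Finite)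
    (s : List α) (n : ℕ) : (sphere R s n).Finite := by
  rw [← toSystem_stateSet hR s n]
  exact (toSystem hR s).stateSet_finite n

theorem sphere_zero {α : Type*} (R : Set (List α × List α)) (s : List α) :
    sphere R s 0 = {s} := by
  ext v; simp [sphere, reach]

theorem IsGrowth.zero {g : ℕ → ℕ} (h : IsGrowth g) : g 0 = 1 := by
  obtain ⟨α, _, R, s, -, -, hg⟩ := h
  rw [← hg, sphere_zero, Set.ncard_singleton]

/-! ### Convolution: two systems on disjoint alphabets -/

theorem eq_map_of_append_eq_map {α β : Type*} {f : α → β} (hf : Function.Injective f)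
    {x y : List β} {r a : List α} (h : x ++ r.map f ++ y = a.map f) :
    ∃ x' y' : List α, x = x'.map f ∧ y = y'.map f ∧ a = x' ++ r ++ y' := by
  obtain ⟨l, y', rfl, hl, rfl⟩ := List.map_eq_append_iff.1 h.symm
  obtain ⟨x', r', rfl, rfl, hr⟩ := List.map_eq_append_iff.1 hl
  obtain rfl := List.map_injective_iff.2 hf hr
  exact ⟨x', y', rfl, rfl, rfl⟩

/-- The image of a rule under a map of alphabets. -/
def mapRule {α β : Type*} (f : α → β) (r : List α × List α) : List β × List β :=
  (r.1.map f, r.2.map f)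

/-- The rules `R` and `S` on disjoint alphabets. -/
def prodRules {α β : Type*} (R : Set (List α × List α)) (S : Set (List β × List β)) :
    Set (List (α ⊕ β) × List (α ⊕ β)) :=
  mapRule Sum.inl '' R ∪ mapRule Sum.inr '' S

/-- The juxtaposition of two words over disjoint alphabets. -/
def juxtapose {α β : Type*} (p : List α × List β) : List (α ⊕ β) :=
  p.1.map Sum.inl ++ p.2.map Sum.inr

theorem juxtapose_injective {α β : Type*} :
    Function.Injective (juxtapose : List α × List β → List (α ⊕ β)) := by
  rintro ⟨a, b⟩ ⟨a', b'⟩ h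
  have h1 := congrArg (List.filterMap Sum.getLeft?) h
  have h2 := congrArg (List.filterMap Sum.getRight?) h
  simp [juxtapose, List.filterMap_map, Function.comp_def] at h1 h2
  simp [h1, h2]

/-- If the occurrence reached past the left block, the last letter of `r` would belong to both
alphabets. For `r = []` this fails: the occurrence could lie inside the right block. -/
theorem exists_of_append_eq_juxtapose_left {α β : Type*} {x y : List (α ⊕ β)} {r a : List α}
    {b : List β} (hr : r ≠ []) (h : x ++ r.map Sum.inl ++ y = juxtapose (a, b)) :
    ∃ x' y' : List α, x = x'.map Sum.inl ∧ y = juxtapose (y', b) ∧ a = x' ++ r ++ y' := by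
  have key : ∃ c, a.map Sum.inl = x ++ r.map Sum.inl ++ c ∧ y = c ++ b.map Sum.inr := by
    rcases List.append_eq_append_iff.1 h with hc | ⟨c, hc, hb⟩
    · exact hc
    · dsimp only at hc hb
      rcases List.eq_nil_or_concat' c with rfl | ⟨c, z, rfl⟩
      · exact ⟨[], by simpa using hc.symm, by simpa using hb.symm⟩
      · exfalso
        obtain ⟨r', w, rfl⟩ := (List.eq_nil_or_concat' r).resolve_left hr
        simp only [List.map_append, ← List.append_assoc] at hc
        have hz := (List.append_inj' hc rfl).2
        have hm : z ∈ b.map (Sum.inr : β → α ⊕ β) := by rw [hb]; simp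
        replace hz : Sum.inl w = z := by simpa using hz
        subst hz
        simp at hm
  obtain ⟨c, hc, rfl⟩ := key
  obtain ⟨x', y', h1, h2, h3⟩ := eq_map_of_append_eq_map Sum.inl_injective hc.symm
  exact ⟨x', y', h1, by rw [h2]; rfl, h3⟩

theorem exists_of_append_eq_juxtapose_right {α β : Type*} {x y : List (α ⊕ β)} {r b : List β}
    {a : List α} (hr : r ≠ []) (h : x ++ r.map Sum.inr ++ y = juxtapose (a, b)) :
    ∃ x' y' : List β, x = juxtapose (a, x') ∧ y = y'.map Sum.inr ∧ b = x' ++ r ++ y' := by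
  have key : ∃ c, x = a.map Sum.inl ++ c ∧ b.map Sum.inr = c ++ r.map Sum.inr ++ y := by
    rw [List.append_assoc] at h
    rcases List.append_eq_append_iff.1 h with ⟨c, hc, hb⟩ | ⟨c, hc, hb⟩
    · dsimp only at hc hb
      rcases c with _ | ⟨z, c⟩
      · exact ⟨[], by simpa using hc.symm, by simpa using hb.symm⟩
      · exfalso
        obtain ⟨w, r', rfl⟩ := List.exists_cons_of_ne_nil hr
        have hm : z ∈ a.map (Sum.inl : α → α ⊕ β) := by rw [hc]; simp
        simp at hb
        simp [← hb.1] at hm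
    · exact ⟨c, hc, by simpa using hb⟩
  obtain ⟨c, rfl, hc⟩ := key
  obtain ⟨x', y', h1, h2, h3⟩ := eq_map_of_append_eq_map Sum.inr_injective hc.symm
  exact ⟨x', y', by rw [h1]; rfl, h2, h3⟩

theorem prod_isProper {α β : Type*} {R : Set (List α × List α)} {S : Set (List β × List β)}
    (hM : IsProper R) (hN : IsProper S) :
    IsProper (prodRules R S) := by
  intro r hr
  simp only [prodRules, Set.mem_union, Set.mem_image] at hr
  rcases hr with ⟨p, hs, rfl⟩ | ⟨p, hs, rfl⟩
  · simpa [mapRule] using hM p hs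
  · simpa [mapRule] using hN p hs

theorem prod_step_iff {α β : Type*} {R : Set (List α × List α)} {S : Set (List β × List β)}
    (hM : IsProper R) (hN : IsProper S) (a : List α) (b : List β) (v : List (α ⊕ β)) :
    Rewrites (prodRules R S) (juxtapose (a, b)) v ↔
      (∃ a', Rewrites R a a' ∧ v = juxtapose (a', b)) ∨
        ∃ b', Rewrites S b b' ∧ v = juxtapose (a, b') := by
  constructor
  · rintro ⟨r, hr, x, y, hu, rfl⟩
    simp only [prodRules, Set.mem_union, Set.mem_image] at hr
    rcases hr with ⟨p, hs, rfl⟩ | ⟨p, hs, rfl⟩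
    · obtain ⟨x', y', rfl, rfl, rfl⟩ := exists_of_append_eq_juxtapose_left (hM p hs) hu.symm
      exact Or.inl ⟨_, ⟨p, hs, x', y', rfl, rfl⟩, by simp [juxtapose, mapRule]⟩
    · obtain ⟨x', y', rfl, rfl, rfl⟩ := exists_of_append_eq_juxtapose_right (hN p hs) hu.symm
      exact Or.inr ⟨_, ⟨p, hs, x', y', rfl, rfl⟩, by simp [juxtapose, mapRule]⟩
  · rintro (⟨a', ⟨p, hs, x, y, rfl, rfl⟩, rfl⟩ | ⟨b', ⟨p, hs, x, y, rfl, rfl⟩, rfl⟩)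
    · refine ⟨mapRule Sum.inl p, ?_, x.map Sum.inl, juxtapose (y, b), ?_, ?_⟩
      · exact Set.mem_union_left _ (Set.mem_image_of_mem _ hs)
      · simp [juxtapose, mapRule]
      · simp [juxtapose, mapRule]
    · refine ⟨mapRule Sum.inr p, ?_, juxtapose (a, x), y.map Sum.inr, ?_, ?_⟩
      · exact Set.mem_union_right _ (Set.mem_image_of_mem _ hs)
      · simp [juxtapose, mapRule]
      · simp [juxtapose, mapRule]

/-- A path in the product is an interleaving of a path in each factor, and the two lengths add up.
-/
theorem mem_prod_reach_iff {α β : Type*} {R : Set (List α × List α)} {S : Set (List β × List β)}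
    (hM : IsProper R) (hN : IsProper S) (s : List α) (t : List β) (n : ℕ)
    (v : List (α ⊕ β)) :
    v ∈ reach (prodRules R S) (juxtapose (s, t)) n ↔
      ∃ k l, k + l = n ∧ ∃ a ∈ reach R s k, ∃ b ∈ reach S t l, v = juxtapose (a, b) := by
  induction n generalizing v with
  | zero =>
    constructor
    · rintro rfl
      exact ⟨0, 0, rfl, _, rfl, _, rfl, rfl⟩
    · rintro ⟨k, l, hkl, a, ha, b, hb, rfl⟩
      obtain ⟨rfl, rfl⟩ : k = 0 ∧ l = 0 := by omega
      obtain rfl := ha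
      obtain rfl := hb
      rfl
  | succ n ih =>
    constructor
    · rintro ⟨u, hu, hs⟩
      obtain ⟨k, l, hkl, a, ha, b, hb, rfl⟩ := (ih u).1 hu
      rcases (prod_step_iff hM hN a b v).1 hs with ⟨a', h, rfl⟩ | ⟨b', h, rfl⟩
      · exact ⟨k + 1, l, by omega, a', ⟨a, ha, h⟩, b, hb, rfl⟩
      · exact ⟨k, l + 1, by omega, a, ha, b', ⟨b, hb, h⟩, rfl⟩
    · rintro ⟨k, l, hkl, a, ha, b, hb, rfl⟩
      rcases k with _ | k
      · rcases l with _ | l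
        · omega
        · obtain ⟨b', hb', h⟩ := hb
          exact ⟨_, (ih _).2 ⟨0, l, by omega, a, ha, b', hb', rfl⟩,
            (prod_step_iff hM hN _ _ _).2 (Or.inr ⟨b, h, rfl⟩)⟩
      · obtain ⟨a', ha', h⟩ := ha
        exact ⟨_, (ih _).2 ⟨k, l, by omega, a', ha', b, hb, rfl⟩,
          (prod_step_iff hM hN _ _ _).2 (Or.inl ⟨a, h, rfl⟩)⟩

theorem exists_mem_sphere {α : Type*} {R : Set (List α × List α)} {s : List α} {n : ℕ}
    {v : List α}
    (h : v ∈ reach R s n) : ∃ k ≤ n, v ∈ sphere R s k := by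
  classical
  exact ⟨Nat.find ⟨n, h⟩, Nat.find_min' _ h, Nat.find_spec (⟨n, h⟩ : ∃ k, v ∈ reach R s k),
    fun m hm => Nat.find_min _ hm⟩

theorem eq_of_mem_sphere {α : Type*} {R : Set (List α × List α)} {s : List α} {m n : ℕ}
    {v : List α}
    (hm : v ∈ sphere R s m) (hn : v ∈ sphere R s n) : m = n := by
  rcases lt_trichotomy m n with h | h | h
  · exact absurd hm.1 (hn.2 m h)
  · exact h
  · exact absurd hn.1 (hm.2 n h)

/-- The factors of a juxtaposition are unique, so minimising the total length amounts to minimising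
the two lengths separately. -/
theorem mem_prod_sphere_iff {α β : Type*} {R : Set (List α × List α)} {S : Set (List β × List β)}
    (hM : IsProper R) (hN : IsProper S) (s : List α) (t : List β) (n : ℕ)
    (v : List (α ⊕ β)) :
    v ∈ sphere (prodRules R S) (juxtapose (s, t)) n ↔
      ∃ k l, k + l = n ∧ ∃ a ∈ sphere R s k, ∃ b ∈ sphere S t l, v = juxtapose (a, b) := by
  constructor
  · rintro ⟨hv, hmin⟩
    obtain ⟨k, l, hkl, a, ha, b, hb, rfl⟩ := (mem_prod_reach_iff hM hN s t n v).1 hv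
    obtain ⟨k', hk', ha'⟩ := exists_mem_sphere ha
    obtain ⟨l', hl', hb'⟩ := exists_mem_sphere hb
    refine ⟨k', l', ?_, a, ha', b, hb', rfl⟩
    by_contra hne
    exact hmin (k' + l') (by omega)
      ((mem_prod_reach_iff hM hN s t _ _).2 ⟨k', l', rfl, a, ha'.1, b, hb'.1, rfl⟩)
  · rintro ⟨k, l, hkl, a, ha, b, hb, rfl⟩
    refine ⟨(mem_prod_reach_iff hM hN s t _ _).2 ⟨k, l, hkl, a, ha.1, b, hb.1, rfl⟩, ?_⟩
    intro m hm hmem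
    obtain ⟨k', l', hkl', a', ha', b', hb', h⟩ := (mem_prod_reach_iff hM hN s t _ _).1 hmem
    have h' := juxtapose_injective h
    simp only [Prod.mk.injEq] at h'
    obtain ⟨rfl, rfl⟩ := h'
    rcases lt_or_ge k' k with hlt | hge
    · exact ha.2 k' hlt ha'
    · exact hb.2 l' (by omega) hb'

theorem IsGrowth.convolution {g h : ℕ → ℕ} (hg : IsGrowth g) (hh : IsGrowth h) :
    IsGrowth fun n => ∑ k ∈ Finset.range (n + 1), g k * h (n - k) := by
  classical
  obtain ⟨α, _, R, s, hR, hM, hg⟩ := hg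
  obtain ⟨β, _, S, t, hS, hN, hh⟩ := hh
  refine ⟨α ⊕ β, inferInstance, prodRules R S, juxtapose (s, t),
    (hR.image _).union (hS.image _), prod_isProper hM hN, fun n => ?_⟩
  have key : sphere (prodRules R S) (juxtapose (s, t)) n =
      ((Finset.range (n + 1)).biUnion fun k =>
        ((sphere_finite hR s k).toFinset ×ˢ (sphere_finite hS t (n - k)).toFinset).image
          juxtapose : Finset (List (α ⊕ β))) := by
    ext v
    rw [mem_prod_sphere_iff hM hN]
    simp only [Finset.coe_biUnion, Set.mem_iUnion, Finset.mem_coe, Finset.mem_range,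
      Finset.mem_image, Finset.mem_product, Set.Finite.mem_toFinset, Prod.exists]
    constructor
    · rintro ⟨k, l, hkl, a, ha, b, hb, rfl⟩
      exact ⟨k, by omega, a, b, ⟨ha, by rwa [show n - k = l by omega]⟩, rfl⟩
    · rintro ⟨k, hk, a, b, ⟨ha, hb⟩, rfl⟩
      exact ⟨k, n - k, by omega, a, ha, b, hb, rfl⟩
  rw [key, Set.ncard_coe_finset, Finset.card_biUnion]
  · refine Finset.sum_congr rfl fun k _ => ?_
    rw [Finset.card_image_of_injective _ juxtapose_injective, Finset.card_product, ← hg, ← hh,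
      Set.ncard_eq_toFinset_card _ (sphere_finite hR s k),
      Set.ncard_eq_toFinset_card _ (sphere_finite hS t (n - k))]
  · intro k _ l _ hkl
    rw [Function.onFun, Finset.disjoint_left]
    simp only [Finset.mem_image, Finset.mem_product, Set.Finite.mem_toFinset, Prod.exists]
    rintro v ⟨a, b, ⟨ha, -⟩, rfl⟩ ⟨a', b', ⟨ha', -⟩, h⟩
    have h' := juxtapose_injective h
    simp only [Prod.mk.injEq] at h'
    obtain ⟨rfl, rfl⟩ := h'
    exact hkl (eq_of_mem_sphere ha ha')

/-! ### Addition: an initial choice between two systems -/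

/-- The rules of a system that first chooses one of two systems, recording the choice in the first
letter, and then runs the chosen system. -/
def sumRules {α β : Type*} (R : Set (List α × List α)) (s : List α) (S : Set (List β × List β))
    (t : List β) :
    Set (List (Option Bool ⊕ (α ⊕ β)) × List (Option Bool ⊕ (α ⊕ β))) :=
  {([Sum.inl none], Sum.inl (some true) :: s.map (Sum.inr ∘ Sum.inl)),
    ([Sum.inl none], Sum.inl (some false) :: t.map (Sum.inr ∘ Sum.inr))} ∪
  (mapRule (Sum.inr ∘ Sum.inl) '' R ∪ mapRule (Sum.inr ∘ Sum.inr) '' S)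

theorem sum_isProper {α β : Type*} {R : Set (List α × List α)} {S : Set (List β × List β)}
    (hM : IsProper R) (hN : IsProper S) (s : List α) (t : List β) :
    IsProper (sumRules R s S t) := by
  intro r hr
  simp only [sumRules, Set.mem_union, Set.mem_image, Set.mem_insert_iff,
    Set.mem_singleton_iff] at hr
  rcases hr with (rfl | rfl) | ⟨p, hs, rfl⟩ | ⟨p, hs, rfl⟩
  · simp
  · simp
  · simpa [mapRule] using hM p hs
  · simpa [mapRule] using hN p hs

theorem cons_map_injective {α β : Type*} {f : α → β} (hf : Function.Injective f) (z : β) :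
    Function.Injective fun a : List α => z :: a.map f := fun _ _ h =>
  List.map_injective_iff.2 hf (List.cons.inj h).2

theorem exists_of_append_eq_cons_map {α β : Type*} {f : α → β} (hf : Function.Injective f)
    {z : β} (hz : ∀ c, f c ≠ z) {x y : List β} {r a : List α} (hr : r ≠ [])
    (h : x ++ r.map f ++ y = z :: a.map f) :
    ∃ x' y' : List α, x = z :: x'.map f ∧ y = y'.map f ∧ a = x' ++ r ++ y' := by
  rcases x with _ | ⟨w, x⟩
  · obtain ⟨c, r, rfl⟩ := List.exists_cons_of_ne_nil hr
    simp only [List.map_cons, List.nil_append, List.cons_append, List.cons.injEq] at h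
    exact absurd h.1 (hz c)
  · simp only [List.cons_append, List.cons.injEq] at h
    obtain ⟨x', y', rfl, rfl, rfl⟩ := eq_map_of_append_eq_map hf h.2
    exact ⟨x', y', by rw [h.1], rfl, rfl⟩

theorem mem_of_append_eq {α : Type*} {x r y u : List α} (h : u = x ++ r ++ y) {z : α}
    (hz : z ∈ r) : z ∈ u := by
  simp [h, hz]

theorem sum_step_init_iff {α β : Type*} {R : Set (List α × List α)} {S : Set (List β × List β)}
    (hM : IsProper R) (hN : IsProper S) (s : List α) (t : List β)
    (v : List (Option Bool ⊕ (α ⊕ β))) :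
    Rewrites (sumRules R s S t) [Sum.inl none] v ↔
      v = Sum.inl (some true) :: s.map (Sum.inr ∘ Sum.inl) ∨
      v = Sum.inl (some false) :: t.map (Sum.inr ∘ Sum.inr) := by
  constructor
  · rintro ⟨r, hr, x, y, hu, rfl⟩
    simp only [sumRules, Set.mem_union, Set.mem_image, Set.mem_insert_iff,
      Set.mem_singleton_iff] at hr
    rcases hr with (rfl | rfl) | ⟨p, hs, rfl⟩ | ⟨p, hs, rfl⟩
    · obtain ⟨rfl, rfl⟩ : x = [] ∧ y = [] := by
        have := congrArg List.length hu
        simp at this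
        constructor <;> apply List.eq_nil_of_length_eq_zero <;> omega
      simp
    · obtain ⟨rfl, rfl⟩ : x = [] ∧ y = [] := by
        have := congrArg List.length hu
        simp at this
        constructor <;> apply List.eq_nil_of_length_eq_zero <;> omega
      simp
    · obtain ⟨c, r, hc⟩ := List.exists_cons_of_ne_nil (hM p hs)
      have := mem_of_append_eq hu (z := Sum.inr (Sum.inl c)) (by simp [mapRule, hc])
      simp at this
    · obtain ⟨c, r, hc⟩ := List.exists_cons_of_ne_nil (hN p hs)
      have := mem_of_append_eq hu (z := Sum.inr (Sum.inr c)) (by simp [mapRule, hc])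
      simp at this
  · rintro (rfl | rfl)
    · exact ⟨_, Or.inl (Or.inl rfl), [], [], by simp, by simp⟩
    · exact ⟨_, Or.inl (Or.inr rfl), [], [], by simp, by simp⟩

theorem sum_step_left_iff {α β : Type*} {R : Set (List α × List α)} {S : Set (List β × List β)}
    (hM : IsProper R) (hN : IsProper S) (s : List α) (t : List β)
    (a : List α) (v : List (Option Bool ⊕ (α ⊕ β))) :
    Rewrites (sumRules R s S t) (Sum.inl (some true) :: a.map (Sum.inr ∘ Sum.inl)) v ↔
      ∃ a', Rewrites R a a' ∧ v = Sum.inl (some true) :: a'.map (Sum.inr ∘ Sum.inl) := by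
  constructor
  · rintro ⟨r, hr, x, y, hu, rfl⟩
    simp only [sumRules, Set.mem_union, Set.mem_image, Set.mem_insert_iff,
      Set.mem_singleton_iff] at hr
    rcases hr with (rfl | rfl) | ⟨p, hs, rfl⟩ | ⟨p, hs, rfl⟩
    · have := mem_of_append_eq hu (z := Sum.inl none) (by simp)
      simp at this
    · have := mem_of_append_eq hu (z := Sum.inl none) (by simp)
      simp at this
    · obtain ⟨x', y', rfl, rfl, rfl⟩ := exists_of_append_eq_cons_map
        (Sum.inr_injective.comp Sum.inl_injective) (by simp) (hM p hs) hu.symm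
      exact ⟨_, ⟨p, hs, x', y', rfl, rfl⟩, by simp [mapRule]⟩
    · obtain ⟨c, r, hc⟩ := List.exists_cons_of_ne_nil (hN p hs)
      have := mem_of_append_eq hu (z := Sum.inr (Sum.inr c)) (by simp [mapRule, hc])
      simp at this
  · rintro ⟨a', ⟨p, hs, x, y, rfl, rfl⟩, rfl⟩
    refine ⟨mapRule (Sum.inr ∘ Sum.inl) p, ?_,
      Sum.inl (some true) :: x.map (Sum.inr ∘ Sum.inl), y.map (Sum.inr ∘ Sum.inl), ?_, ?_⟩
    · exact Set.mem_union_right _ (Set.mem_union_left _ (Set.mem_image_of_mem _ hs))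
    · simp [mapRule]
    · simp [mapRule]

theorem sum_step_right_iff {α β : Type*} {R : Set (List α × List α)} {S : Set (List β × List β)}
    (hM : IsProper R) (hN : IsProper S) (s : List α) (t : List β)
    (b : List β) (v : List (Option Bool ⊕ (α ⊕ β))) :
    Rewrites (sumRules R s S t) (Sum.inl (some false) :: b.map (Sum.inr ∘ Sum.inr)) v ↔
      ∃ b', Rewrites S b b' ∧ v = Sum.inl (some false) :: b'.map (Sum.inr ∘ Sum.inr) := by
  constructor
  · rintro ⟨r, hr, x, y, hu, rfl⟩
    simp only [sumRules, Set.mem_union, Set.mem_image, Set.mem_insert_iff,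
      Set.mem_singleton_iff] at hr
    rcases hr with (rfl | rfl) | ⟨p, hs, rfl⟩ | ⟨p, hs, rfl⟩
    · have := mem_of_append_eq hu (z := Sum.inl none) (by simp)
      simp at this
    · have := mem_of_append_eq hu (z := Sum.inl none) (by simp)
      simp at this
    · obtain ⟨c, r, hc⟩ := List.exists_cons_of_ne_nil (hM p hs)
      have := mem_of_append_eq hu (z := Sum.inr (Sum.inl c)) (by simp [mapRule, hc])
      simp at this
    · obtain ⟨x', y', rfl, rfl, rfl⟩ := exists_of_append_eq_cons_map
        (Sum.inr_injective.comp Sum.inr_injective) (by simp) (hN p hs) hu.symm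
      exact ⟨_, ⟨p, hs, x', y', rfl, rfl⟩, by simp [mapRule]⟩
  · rintro ⟨a', ⟨p, hs, x, y, rfl, rfl⟩, rfl⟩
    refine ⟨mapRule (Sum.inr ∘ Sum.inr) p, ?_,
      Sum.inl (some false) :: x.map (Sum.inr ∘ Sum.inr), y.map (Sum.inr ∘ Sum.inr), ?_, ?_⟩
    · exact Set.mem_union_right _ (Set.mem_union_right _ (Set.mem_image_of_mem _ hs))
    · simp [mapRule]
    · simp [mapRule]

/-- The starting letter is consumed by the first step and never produced again; the marker left in
its place is in no left-hand side, so afterwards only the chosen system runs. -/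
theorem sum_reach_succ {α β : Type*} {R : Set (List α × List α)} {S : Set (List β × List β)}
    (hM : IsProper R) (hN : IsProper S) (s : List α) (t : List β) (n : ℕ) :
    reach (sumRules R s S t) [Sum.inl none] (n + 1) =
      (fun a => Sum.inl (some true) :: a.map (Sum.inr ∘ Sum.inl)) '' reach R s n ∪
      (fun b => Sum.inl (some false) :: b.map (Sum.inr ∘ Sum.inr)) '' reach S t n := by
  induction n with
  | zero =>
    ext v
    have h : v ∈ reach (sumRules R s S t) [Sum.inl none] (0 + 1) ↔
        Rewrites (sumRules R s S t) [Sum.inl none] v := by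
      simp [reach]
    rw [h, sum_step_init_iff hM hN s t]
    simp [reach, or_comm]
  | succ n ih =>
    ext v
    rw [reach, Set.mem_ofPred_eq, ih]
    constructor
    · rintro ⟨u, ⟨a, ha, rfl⟩ | ⟨a, ha, rfl⟩, hs⟩
      · obtain ⟨a', h, rfl⟩ := (sum_step_left_iff hM hN s t a v).1 hs
        exact Or.inl ⟨a', ⟨a, ha, h⟩, rfl⟩
      · obtain ⟨a', h, rfl⟩ := (sum_step_right_iff hM hN s t a v).1 hs
        exact Or.inr ⟨a', ⟨a, ha, h⟩, rfl⟩
    · rintro (⟨a', ⟨a, ha, h⟩, rfl⟩ | ⟨a', ⟨a, ha, h⟩, rfl⟩)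
      · exact ⟨_, Or.inl ⟨a, ha, rfl⟩, (sum_step_left_iff hM hN s t _ _).2 ⟨a', h, rfl⟩⟩
      · exact ⟨_, Or.inr ⟨a, ha, rfl⟩, (sum_step_right_iff hM hN s t _ _).2 ⟨a', h, rfl⟩⟩

theorem sum_sphere_succ {α β : Type*} {R : Set (List α × List α)} {S : Set (List β × List β)}
    (hM : IsProper R) (hN : IsProper S) (s : List α) (t : List β) (n : ℕ) :
    sphere (sumRules R s S t) [Sum.inl none] (n + 1) =
      (fun a => Sum.inl (some true) :: a.map (Sum.inr ∘ Sum.inl)) '' sphere R s n ∪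
      (fun b => Sum.inl (some false) :: b.map (Sum.inr ∘ Sum.inr)) '' sphere S t n := by
  have hl := cons_map_injective (Sum.inr_injective.comp Sum.inl_injective)
    (Sum.inl (some true) : Option Bool ⊕ (α ⊕ β))
  have hr := cons_map_injective (Sum.inr_injective.comp Sum.inr_injective)
    (Sum.inl (some false) : Option Bool ⊕ (α ⊕ β))
  ext v
  rw [sphere, Set.mem_ofPred_eq, sum_reach_succ hM hN s t]
  constructor
  · rintro ⟨⟨a, ha, rfl⟩ | ⟨a, ha, rfl⟩, hmin⟩
    · refine Or.inl ⟨a, ⟨ha, fun m hm h => hmin (m + 1) (by omega) ?_⟩, rfl⟩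
      rw [sum_reach_succ hM hN s t]
      exact Or.inl ⟨a, h, rfl⟩
    · refine Or.inr ⟨a, ⟨ha, fun m hm h => hmin (m + 1) (by omega) ?_⟩, rfl⟩
      rw [sum_reach_succ hM hN s t]
      exact Or.inr ⟨a, h, rfl⟩
  · rintro (⟨a, ha, rfl⟩ | ⟨a, ha, rfl⟩)
    · refine ⟨Or.inl ⟨a, ha.1, rfl⟩, fun m hm h => ?_⟩
      rcases m with _ | m
      · have h0 : reach (sumRules R s S t) [Sum.inl none] 0 = {[Sum.inl none]} := rfl
        rw [h0] at h
        simp at h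
      · rw [sum_reach_succ hM hN s t] at h
        rcases h with ⟨b, hb, h⟩ | ⟨b, hb, h⟩
        · exact ha.2 m (by omega) (hl h ▸ hb)
        · simp at h
    · refine ⟨Or.inr ⟨a, ha.1, rfl⟩, fun m hm h => ?_⟩
      rcases m with _ | m
      · have h0 : reach (sumRules R s S t) [Sum.inl none] 0 = {[Sum.inl none]} := rfl
        rw [h0] at h
        simp at h
      · rw [sum_reach_succ hM hN s t] at h
        rcases h with ⟨b, hb, h⟩ | ⟨b, hb, h⟩
        · simp at h
        · exact ha.2 m (by omega) (hr h ▸ hb)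

/-- The choice costs one step, hence the shift. The marker keeps the two branches disjoint, even on
the empty word. -/
theorem IsGrowth.add {g h : ℕ → ℕ} (hg : IsGrowth g) (hh : IsGrowth h) :
    ∃ f, IsGrowth f ∧ ∀ n, f (n + 1) = g n + h n := by
  obtain ⟨α, _, R, s, hR, hM, hg⟩ := hg
  obtain ⟨β, _, S, t, hS, hN, hh⟩ := hh
  refine ⟨_, ⟨Option Bool ⊕ (α ⊕ β), inferInstance, sumRules R s S t, [Sum.inl none],
    (Set.toFinite _).union ((hR.image _).union (hS.image _)), sum_isProper hM hN s t,
    fun _ => rfl⟩, fun n => ?_⟩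
  rw [sum_sphere_succ hM hN s t, Set.ncard_union_eq ?_ ((sphere_finite hR s n).image _)
    ((sphere_finite hS t n).image _), Set.ncard_image_of_injective,
    Set.ncard_image_of_injective, hg, hh]
  · exact cons_map_injective (Sum.inr_injective.comp Sum.inr_injective) _
  · exact cons_map_injective (Sum.inr_injective.comp Sum.inl_injective) _
  · rw [Set.disjoint_left]
    rintro v ⟨a, -, rfl⟩ ⟨b, -, h⟩
    simp at h

/-! ### The clock: a sweeping head that extends a walk at every tick -/

theorem append_cons_injective {α : Type*} {p : α → Prop} {a b x y : List α} {h h' : α}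
    (ha : ∀ z ∈ a, ¬ p z) (hb : ∀ z ∈ b, ¬ p z) (hp' : p h')
    (e : a ++ h :: b = x ++ h' :: y) : a = x ∧ h = h' ∧ b = y := by
  induction a generalizing x with
  | nil =>
    rcases x with _ | ⟨z, x⟩
    · simpa using e
    · simp only [List.nil_append, List.cons_append, List.cons.injEq] at e
      exact absurd hp' (hb h' (by rw [e.2]; simp))
  | cons c a ih =>
    rcases x with _ | ⟨z, x⟩
    · simp only [List.nil_append, List.cons_append, List.cons.injEq] at e
      exact absurd (e.1 ▸ hp') (ha c (by simp))
    · simp only [List.cons_append, List.cons.injEq] at e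
      obtain ⟨h1, h2, h3⟩ := ih (fun z hz => ha z (by simp [hz])) e.2
      exact ⟨by rw [e.1, h1], h2, h3⟩

/-- The letters of the clock: the right end of the tape, a tape cell, and the two states of the
head. -/
inductive ClockLetter
  | wall
  | cell
  | rightHead
  | leftHead

instance : Finite ClockLetter :=
  Finite.of_surjective
    (fun i : Fin 4 => match i with
      | 0 => ClockLetter.wall
      | 1 => ClockLetter.cell
      | 2 => ClockLetter.rightHead
      | 3 => ClockLetter.leftHead)
    (by rintro (_ | _ | _ | _)
        exacts [⟨0, rfl⟩, ⟨1, rfl⟩, ⟨2, rfl⟩, ⟨3, rfl⟩])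

/-- The configurations of the clock: the head with `i` cells to its left and `j` cells to its
right. -/
inductive ClockState
  | right (i j : ℕ)
  | left (i j : ℕ)

open ClockLetter ClockState

/-- The head letters. -/
def IsHead {C : Type*} (z : C ⊕ ClockLetter) : Prop :=
  z = Sum.inr rightHead ∨ z = Sum.inr leftHead

/-- The word formed by a history `w` and a configuration of the clock. -/
def encode {C : Type*} (w : List C) : ClockState → List (C ⊕ ClockLetter)
  | right i j => (w.map Sum.inl ++ List.replicate i (Sum.inr cell)) ++
      Sum.inr rightHead :: (List.replicate j (Sum.inr cell) ++ [Sum.inr wall])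
  | left i j => (w.map Sum.inl ++ List.replicate i (Sum.inr cell)) ++
      Sum.inr leftHead :: (List.replicate j (Sum.inr cell) ++ [Sum.inr wall])

theorem not_isHead_prefix {C : Type*} (w : List C) (i : ℕ) :
    ∀ z ∈ w.map Sum.inl ++ List.replicate i (Sum.inr cell), ¬ IsHead z := by
  intro z hz
  simp only [List.mem_append, List.mem_map, List.mem_replicate] at hz
  rcases hz with ⟨c, -, rfl⟩ | ⟨-, rfl⟩ <;> simp [IsHead]

theorem not_isHead_suffix {C : Type*} (j : ℕ) :
    ∀ z ∈ List.replicate j (Sum.inr cell) ++ [(Sum.inr wall : C ⊕ ClockLetter)], ¬ IsHead z := by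
  intro z hz
  simp only [List.mem_append, List.mem_replicate, List.mem_singleton] at hz
  rcases hz with ⟨-, rfl⟩ | rfl <;> simp [IsHead]

/-- The rules of the walk clock. The head moves back and forth on the tape. On the way to the left
every cell is replaced by `d` cells, and at the left end `e` cells are added and the walk along the
relation `E` makes one step. -/
inductive WalkClockRule {C : Type*} (E : C → C → Prop) (d e : ℕ) :
    List (C ⊕ ClockLetter) × List (C ⊕ ClockLetter) → Prop
  | moveRight : WalkClockRule E d e
      ([] ++ Sum.inr rightHead :: [Sum.inr cell], [Sum.inr cell, Sum.inr rightHead])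
  | turn : WalkClockRule E d e
      ([] ++ Sum.inr rightHead :: [Sum.inr wall], [Sum.inr leftHead, Sum.inr wall])
  | moveLeft : WalkClockRule E d e
      ([Sum.inr cell] ++ Sum.inr leftHead :: [],
        Sum.inr leftHead :: List.replicate d (Sum.inr cell))
  | tick (q q' : C) (h : E q q') : WalkClockRule E d e
      ([Sum.inl q] ++ Sum.inr leftHead :: [],
        [Sum.inl q, Sum.inl q', Sum.inr rightHead] ++ List.replicate e (Sum.inr cell))

theorem finite_walkClockRule {C : Type*} [Finite C] (E : C → C → Prop) (d e : ℕ) :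
    {r | WalkClockRule E d e r}.Finite := by
  have hfin : (Set.range fun p : C × C => (([Sum.inl p.1] ++ Sum.inr leftHead :: [],
        [Sum.inl p.1, Sum.inl p.2, Sum.inr rightHead] ++ List.replicate e (Sum.inr cell)) :
      List (C ⊕ ClockLetter) × List (C ⊕ ClockLetter))).Finite := Set.finite_range _
  refine (((hfin.insert ([] ++ Sum.inr rightHead :: [Sum.inr cell],
    [Sum.inr cell, Sum.inr rightHead])).insert ([] ++ Sum.inr rightHead :: [Sum.inr wall],
      [Sum.inr leftHead, Sum.inr wall])).insert ([Sum.inr cell] ++ Sum.inr leftHead :: [],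
        Sum.inr leftHead :: List.replicate d (Sum.inr cell))).subset ?_
  rintro r (_ | _ | _ | ⟨q, q', h⟩)
  · exact Or.inr (Or.inr (Or.inl rfl))
  · exact Or.inr (Or.inl rfl)
  · exact Or.inl rfl
  · exact Or.inr (Or.inr (Or.inr ⟨(q, q'), rfl⟩))

/-- The next configuration of the clock. -/
def ClockState.next (d e : ℕ) : ClockState → ClockState
  | right i (j + 1) => right (i + 1) j
  | right i 0 => left i 0
  | left (i + 1) j => left i (d + j)
  | left 0 j => right 0 (e + j)

/-- Whether the walk makes a step when the clock leaves the given configuration. -/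
def ClockState.Ticks : ClockState → Prop
  | left 0 _ => True
  | _ => False

/-- Every left-hand side has exactly one head letter, and so does the word, so an occurrence is
pinned at the head. The left-hand sides have the shape `p ++ h :: t` so that `append_cons_injective`
applies; the letters next to the head then select the rule. -/
theorem rewrites_encode_iff {C : Type*} (E : C → C → Prop) (d e : ℕ) (w : List C) (q : C)
    (s : ClockState) (v : List (C ⊕ ClockLetter)) :
    Rewrites {r | WalkClockRule E d e r} (encode (w ++ [q]) s) v ↔
      (¬ s.Ticks ∧ v = encode (w ++ [q]) (s.next d e)) ∨
      (s.Ticks ∧ ∃ q', E q q' ∧ v = encode (w ++ [q] ++ [q']) (s.next d e)) := by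
  constructor
  · rintro ⟨r, hr, x, y, hu, rfl⟩
    rcases s with ⟨i, j⟩ | ⟨i, j⟩
    · have key := fun h p t (hh : IsHead h) (he : r.1 = p ++ h :: t) =>
        append_cons_injective (x := x ++ p) (y := t ++ y) (not_isHead_prefix (w ++ [q]) i)
          (not_isHead_suffix j) hh (hu.trans (by simp [he]))
      rcases hr with _ | _ | _ | ⟨q₁, q', h⟩
      · obtain ⟨h1, -, h3⟩ := key _ _ _ (Or.inl rfl) rfl
        rcases j with _ | j
        · simp at h3
        · simp only [List.replicate_succ, List.cons_append, List.nil_append, List.cons.injEq,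
            true_and, List.append_nil] at h3 h1
          refine Or.inl ⟨id, ?_⟩
          simp [encode, ClockState.next, ← h1, ← h3, List.replicate_succ']
      · obtain ⟨h1, -, h3⟩ := key _ _ _ (Or.inl rfl) rfl
        rcases j with _ | j
        · simp only [List.replicate_zero, List.cons_append, List.nil_append, List.cons.injEq,
            true_and, List.append_nil] at h3 h1
          refine Or.inl ⟨id, ?_⟩
          simp [encode, ClockState.next, ← h1, ← h3]
        · simp [List.replicate_succ] at h3
      · obtain ⟨-, h2, -⟩ := key _ _ _ (Or.inr rfl) rfl
        simp at h2
      · obtain ⟨-, h2, -⟩ := key _ _ _ (Or.inr rfl) rfl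
        simp at h2
    · have key := fun h p t (hh : IsHead h) (he : r.1 = p ++ h :: t) =>
        append_cons_injective (x := x ++ p) (y := t ++ y) (not_isHead_prefix (w ++ [q]) i)
          (not_isHead_suffix j) hh (hu.trans (by simp [he]))
      rcases hr with _ | _ | _ | ⟨q₁, q', h⟩
      · obtain ⟨-, h2, -⟩ := key _ _ _ (Or.inl rfl) rfl
        simp at h2
      · obtain ⟨-, h2, -⟩ := key _ _ _ (Or.inl rfl) rfl
        simp at h2
      · obtain ⟨h1, -, h3⟩ := key _ _ _ (Or.inr rfl) rfl
        rcases i with _ | i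
        · rw [List.map_append, List.replicate_zero, List.append_nil] at h1
          have := (List.append_inj' h1 rfl).2
          simp at this
        · rw [List.replicate_succ', ← List.append_assoc] at h1
          obtain ⟨h1, -⟩ := List.append_inj' h1 rfl
          refine Or.inl ⟨id, ?_⟩
          simp only [List.nil_append] at h3
          simp [encode, ClockState.next, ← h1, ← h3, List.replicate_add,
            -List.replicate_append_replicate]
      · obtain ⟨h1, -, h3⟩ := key _ _ _ (Or.inr rfl) rfl
        rcases i with _ | i
        · simp only [List.map_append, List.replicate_zero, List.append_nil] at h1
          obtain ⟨h4, h5⟩ := List.append_inj' h1 rfl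
          obtain rfl : q = q₁ := by simpa using h5
          refine Or.inr ⟨trivial, q', h, ?_⟩
          simp only [List.nil_append] at h3
          simp [encode, ClockState.next, ← h4, ← h3, List.replicate_add,
            -List.replicate_append_replicate]
        · rw [List.replicate_succ', ← List.append_assoc] at h1
          have := (List.append_inj' h1 rfl).2
          simp at this
  · rintro (⟨hs, rfl⟩ | ⟨hs, q', h, rfl⟩)
    · rcases s with ⟨i, _ | j⟩ | ⟨_ | i, j⟩
      · exact ⟨_, .turn, (w ++ [q]).map Sum.inl ++ List.replicate i (Sum.inr cell), [],
          by simp [encode], by simp [encode, ClockState.next]⟩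
      · exact ⟨_, .moveRight, (w ++ [q]).map Sum.inl ++ List.replicate i (Sum.inr cell),
          List.replicate j (Sum.inr cell) ++ [Sum.inr wall],
          by simp [encode, List.replicate_succ],
          by simp [encode, ClockState.next, List.replicate_succ']⟩
      · exact absurd trivial hs
      · exact ⟨_, .moveLeft, (w ++ [q]).map Sum.inl ++ List.replicate i (Sum.inr cell),
          List.replicate j (Sum.inr cell) ++ [Sum.inr wall],
          by simp [encode, List.replicate_succ'],
          by simp [encode, ClockState.next, List.replicate_add,
            -List.replicate_append_replicate]⟩
    · rcases s with ⟨i, j⟩ | ⟨_ | i, j⟩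
      · exact hs.elim
      · exact ⟨_, .tick q q' h, w.map Sum.inl,
          List.replicate j (Sum.inr cell) ++ [Sum.inr wall],
          by simp [encode], by simp [encode, ClockState.next, List.replicate_add,
            -List.replicate_append_replicate]⟩
      · exact hs.elim

theorem encode_injective {C : Type*} {w w' : List C} {s s' : ClockState}
    (h : encode w s = encode w' s') : w = w' ∧ s = s' := by
  have hw : w = w' := by
    have h1 := congrArg (List.filterMap Sum.getLeft?) h
    have key : ∀ (w : List C) s, (encode w s).filterMap Sum.getLeft? = w := by
      rintro w (⟨i, j⟩ | ⟨i, j⟩) <;>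
      simp [encode, List.filterMap_map, Function.comp_def, List.filterMap_replicate]
    rwa [key, key] at h1
  subst hw
  refine ⟨rfl, ?_⟩
  have hlen : ∀ {i i' j j' : ℕ} {z z' : C ⊕ ClockLetter}, IsHead z → IsHead z' →
      (w.map Sum.inl ++ List.replicate i (Sum.inr cell)) ++
        z :: (List.replicate j (Sum.inr cell) ++ [Sum.inr wall]) =
      (w.map Sum.inl ++ List.replicate i' (Sum.inr cell)) ++
        z' :: (List.replicate j' (Sum.inr cell) ++ [Sum.inr wall]) → i = i' ∧ z = z' ∧ j = j' := by
    intro i i' j j' z z' _ hz' he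
    obtain ⟨h1, h2, h3⟩ := append_cons_injective (not_isHead_prefix w i) (not_isHead_suffix j) hz' he
    exact ⟨by simpa using congrArg List.length h1, h2, by simpa using congrArg List.length h3⟩
  rcases s with ⟨i, j⟩ | ⟨i, j⟩ <;> rcases s' with ⟨i', j'⟩ | ⟨i', j'⟩
  · obtain ⟨rfl, -, rfl⟩ := hlen (Or.inl rfl) (Or.inl rfl) h
    rfl
  · simpa using (hlen (Or.inl rfl) (Or.inr rfl) h).2.1
  · simpa using (hlen (Or.inr rfl) (Or.inl rfl) h).2.1
  · obtain ⟨rfl, -, rfl⟩ := hlen (Or.inr rfl) (Or.inr rfl) h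
    rfl

/-- The walks with `k` steps that start at `q₀`, as lists of vertices. -/
def walks {C : Type*} (E : C → C → Prop) (q₀ : C) : ℕ → Set (List C)
  | 0 => {[q₀]}
  | k + 1 => {v | ∃ w q q', w ++ [q] ∈ walks E q₀ k ∧ E q q' ∧ v = w ++ [q] ++ [q']}

theorem exists_eq_append_of_mem_walks {C : Type*} {E : C → C → Prop} {q₀ : C} {k : ℕ} {v : List C}
    (h : v ∈ walks E q₀ k) : ∃ w q, v = w ++ [q] := by
  rcases k with _ | k
  · exact ⟨[], q₀, h⟩
  · obtain ⟨w, q, q', -, -, rfl⟩ := h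
    exact ⟨w ++ [q], q', rfl⟩

theorem length_of_mem_walks {C : Type*} {E : C → C → Prop} {q₀ : C} {k : ℕ} {v : List C}
    (h : v ∈ walks E q₀ k) : v.length = k + 1 := by
  induction k generalizing v with
  | zero => obtain rfl := h; rfl
  | succ k ih =>
    obtain ⟨w, q, q', hw, -, rfl⟩ := h
    simpa using ih hw

open Classical in
/-- The number of ticks before time `n`, and the configuration at time `n`. -/
noncomputable def clock (d e m : ℕ) : ℕ → ℕ × ClockState
  | 0 => (0, right 0 m)
  | n + 1 =>
    ((clock d e m n).1 + if (clock d e m n).2.Ticks then 1 else 0, (clock d e m n).2.next d e)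

/-- The motion of the head does not depend on the letters of the walk, so all words of one
generation share the same clock configuration. -/
theorem reach_walkClock {C : Type*} (E : C → C → Prop) (q₀ : C) (d e m n : ℕ) :
    reach {r | WalkClockRule E d e r} (encode [q₀] (right 0 m)) n =
      (fun w => encode w (clock d e m n).2) '' walks E q₀ (clock d e m n).1 := by
  induction n with
  | zero => simp [reach, clock, walks]
  | succ n ih =>
    ext v
    rw [reach, ih]
    constructor
    · rintro ⟨u, ⟨w, hw, rfl⟩, hs⟩
      obtain ⟨w, q, rfl⟩ := exists_eq_append_of_mem_walks hw
      rcases (rewrites_encode_iff E d e w q _ v).1 hs with ⟨ht, rfl⟩ | ⟨ht, q', h, rfl⟩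
      · exact ⟨w ++ [q], by simpa [clock, ht] using hw, rfl⟩
      · refine ⟨w ++ [q] ++ [q'], ?_, rfl⟩
        simp only [clock, ht, if_true]
        exact ⟨w, q, q', hw, h, rfl⟩
    · rintro ⟨v, hv, rfl⟩
      by_cases ht : (clock d e m n).2.Ticks
      · simp only [clock, ht, if_true] at hv
        obtain ⟨w, q, q', hw, h, rfl⟩ := hv
        exact ⟨_, ⟨_, hw, rfl⟩, (rewrites_encode_iff E d e w q _ _).2 (Or.inr ⟨ht, q', h, rfl⟩)⟩
      · simp only [clock, ht, if_false, add_zero] at hv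
        obtain ⟨w, q, rfl⟩ := exists_eq_append_of_mem_walks hv
        exact ⟨_, ⟨_, hv, rfl⟩, (rewrites_encode_iff E d e w q _ _).2 (Or.inl ⟨ht, rfl⟩)⟩

/-- The length of the tape after `k` ticks. -/
def tapeLength (d e m : ℕ) : ℕ → ℕ
  | 0 => m
  | k + 1 => d * tapeLength d e m k + e

/-- The time of the `k`-th tick. -/
def tickTime (d e m : ℕ) : ℕ → ℕ
  | 0 => 0
  | k + 1 => tickTime d e m k + 2 * tapeLength d e m k + 2

/-- The clock is in configuration `s` at time `n`, after `k` ticks. -/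
def IsTimeOf (d e m k n : ℕ) : ClockState → Prop
  | right i j => i + j = tapeLength d e m k ∧ n = tickTime d e m k + i
  | left i j => ∃ l, i + l = tapeLength d e m k ∧ j = d * l ∧
      n = tickTime d e m k + tapeLength d e m k + 1 + l

/-- During a left sweep, `l` counts the cells already replaced, so `j = d * l`. At the left end `l`
is the whole tape length, and the `e` new cells yield the recursion of `tapeLength`. -/
theorem isTimeOf_clock (d e m n : ℕ) :
    IsTimeOf d e m (clock d e m n).1 n (clock d e m n).2 := by
  induction n with
  | zero => simp [clock, IsTimeOf, tapeLength, tickTime]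
  | succ n ih =>
    rw [clock]
    generalize clock d e m n = p at ih
    obtain ⟨k, ⟨i, _ | j⟩ | ⟨_ | i, j⟩⟩ := p
    · simp only [IsTimeOf, ClockState.next, ClockState.Ticks, ↓reduceIte,
        add_zero] at ih ⊢
      exact ⟨0, by omega, by simp, by omega⟩
    · simp only [IsTimeOf, ClockState.next, ClockState.Ticks, ↓reduceIte,
        add_zero] at ih ⊢
      omega
    · simp only [IsTimeOf, ClockState.next, ClockState.Ticks, ↓reduceIte] at ih ⊢
      obtain ⟨l, h1, rfl, h2⟩ := ih
      obtain rfl : l = tapeLength d e m k := by omega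
      simp only [tapeLength, tickTime]
      omega
    · simp only [IsTimeOf, ClockState.next, ClockState.Ticks, ↓reduceIte,
        add_zero] at ih ⊢
      obtain ⟨l, h1, rfl, h2⟩ := ih
      exact ⟨l + 1, by omega, by ring, by omega⟩

/-- Tick number and configuration determine the time; this is what excludes the return of a word in
a later generation. -/
theorem clock_injective (d e m : ℕ) : Function.Injective (clock d e m) := by
  intro n n' h
  have h1 := isTimeOf_clock d e m n
  have h2 := isTimeOf_clock d e m n'
  rw [h] at h1
  generalize clock d e m n' = p at h1 h2
  obtain ⟨k, ⟨i, j⟩ | ⟨i, j⟩⟩ := p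
  · simp only [IsTimeOf] at h1 h2
    omega
  · obtain ⟨l, h1, -, h1'⟩ := h1
    obtain ⟨l', h2, -, h2'⟩ := h2
    omega

theorem tickTime_clock_le (d e m n : ℕ) : tickTime d e m (clock d e m n).1 ≤ n := by
  have h := isTimeOf_clock d e m n
  generalize clock d e m n = p at h
  obtain ⟨k, ⟨i, j⟩ | ⟨i, j⟩⟩ := p
  · simp only [IsTimeOf] at h ⊢
    omega
  · obtain ⟨l, h1, -, h2⟩ := h
    dsimp only at h1 h2 ⊢
    omega

theorem lt_tickTime_clock_succ (d e m n : ℕ) : n < tickTime d e m ((clock d e m n).1 + 1) := by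
  have h := isTimeOf_clock d e m n
  generalize clock d e m n = p at h
  obtain ⟨k, ⟨i, j⟩ | ⟨i, j⟩⟩ := p
  · simp only [IsTimeOf, tickTime] at h ⊢
    omega
  · obtain ⟨l, h1, -, h2⟩ := h
    simp only [tickTime] at h1 h2 ⊢
    omega

theorem isGrowth_walkClock {C : Type} [Finite C] (E : C → C → Prop) (q₀ : C) (d e m : ℕ) :
    IsGrowth fun n => (walks E q₀ (clock d e m n).1).ncard := by
  refine ⟨C ⊕ ClockLetter, inferInstance, {r | WalkClockRule E d e r}, encode [q₀] (right 0 m),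
    finite_walkClockRule E d e, ?_, fun n => ?_⟩
  · rintro r (_ | _ | _ | _) <;> simp
  · have h : sphere {r | WalkClockRule E d e r} (encode [q₀] (right 0 m)) n =
        reach {r | WalkClockRule E d e r} (encode [q₀] (right 0 m)) n := by
      refine Set.Subset.antisymm (fun v h => h.1) fun v h => ⟨h, fun k hk h' => ?_⟩
      rw [reach_walkClock] at h h'
      obtain ⟨w, hw, rfl⟩ := h
      obtain ⟨w', hw', h'⟩ := h'
      obtain ⟨rfl, hs⟩ := encode_injective h'
      -- The length of the history reveals the number of ticks.
      have hlen := (length_of_mem_walks hw).symm.trans (length_of_mem_walks hw')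
      exact hk.ne (clock_injective d e m (Prod.ext (by omega) hs))
    rw [h, reach_walkClock, Set.ncard_image_of_injective]
    exact fun w w' h => (encode_injective h).1

theorem ncard_walks_complete {C : Type*} [Finite C] (q₀ : C) (k : ℕ) :
    (walks (fun _ _ => True) q₀ k).ncard = Nat.card C ^ k := by
  have : Fintype C := Fintype.ofFinite C
  have h : walks (fun _ _ => True) q₀ k = (q₀ :: ·) '' {l : List C | l.length = k} := by
    induction k with
    | zero => simp [walks, List.length_eq_zero_iff]
    | succ k ih =>
      ext v
      rw [walks, ih]
      constructor
      · rintro ⟨w, q, q', ⟨l, hl, h⟩, -, rfl⟩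
        refine ⟨l ++ [q'], by simpa using hl, ?_⟩
        rw [← h]
        rfl
      · rintro ⟨l, hl, rfl⟩
        obtain ⟨l, q', rfl⟩ := (List.eq_nil_or_concat' l).resolve_left
          (by rintro rfl; simp at hl)
        obtain ⟨w, q, hw⟩ := (List.eq_nil_or_concat' (q₀ :: l)).resolve_left (by simp)
        exact ⟨w, q, q', ⟨l, by simpa using hl, hw⟩, trivial, by simp [← hw]⟩
  rw [h, Set.ncard_image_of_injective _ (List.cons_injective), Nat.card_eq_fintype_card,
    ← card_vector]
  exact (Nat.card_coe_set_eq _).symm.trans (Nat.card_eq_fintype_card (α := List.Vector C k))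

/-- The only forbidden step is from `false` to `true`, so a walk is determined by the moment at
which it leaves `true`. -/
theorem walks_bool (k : ℕ) :
    walks (fun q q' : Bool => q = true ∨ q' = false) true k =
      (fun i => List.replicate (i + 1) true ++ List.replicate (k - i) false) ''
        (Finset.range (k + 1) : Set ℕ) := by
  induction k with
  | zero => simp [walks]
  | succ k ih =>
    ext v
    rw [walks, ih]
    constructor
    · rintro ⟨w, q, q', ⟨i, hi, h⟩, hq, rfl⟩
      rw [Finset.mem_coe, Finset.mem_range] at hi
      dsimp only at h
      cases q'
      · refine ⟨i, by simp; omega, ?_⟩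
        dsimp only
        rw [← h, show k + 1 - i = (k - i) + 1 by omega, List.replicate_succ' (n := k - i)]
        simp
      · obtain rfl : q = true := by simpa using hq
        have hk : k - i = 0 := by
          rcases hki : k - i with _ | j
          · rfl
          · rw [hki, List.replicate_succ' (n := j), ← List.append_assoc] at h
            simpa using (List.append_inj' h rfl).2
        refine ⟨k + 1, by simp, ?_⟩
        obtain rfl : i = k := by omega
        dsimp only
        rw [← h, List.replicate_succ' (n := i + 1)]
        simp
    · rintro ⟨i, hi, rfl⟩
      rw [Finset.mem_coe, Finset.mem_range] at hi
      rcases Nat.lt_or_ge i (k + 1) with hlt | hge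
      · obtain ⟨w, q, hw⟩ := (List.eq_nil_or_concat'
          (List.replicate (i + 1) true ++ List.replicate (k - i) false)).resolve_left (by simp)
        refine ⟨w, q, false, ⟨i, by simpa using hlt, hw⟩, Or.inr rfl, ?_⟩
        dsimp only
        rw [← hw, show k + 1 - i = (k - i) + 1 by omega]
        simp only [List.replicate_succ' (n := k - i), List.append_assoc]
      · obtain rfl : i = k + 1 := by omega
        refine ⟨List.replicate k true, true, true, ⟨k, by simp, ?_⟩, Or.inl rfl, ?_⟩
        · simp [List.replicate_succ']
        · simp [List.replicate_succ']

theorem ncard_walks_bool (k : ℕ) :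
    (walks (fun q q' : Bool => q = true ∨ q' = false) true k).ncard = k + 1 := by
  rw [walks_bool, Set.ncard_image_of_injective, Set.ncard_coe_finset, Finset.card_range]
  intro i j h
  simpa [List.count_replicate] using congrArg (List.count true) h

/-! ### Comparison up to bounded factors -/

/-- Consecutive values of `g` are comparable. -/
def IsTame (g : ℕ → ℕ) : Prop :=
  ∃ C : ℝ, 1 ≤ C ∧ ∀ n, (g n : ℝ) ≤ C * g (n + 1) ∧ (g (n + 1) : ℝ) ≤ C * g n

/-- `u` is comparable on `[2, ∞)` to a tame growth function, evaluated at the integer part. -/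
def IsGrowthLike (u : ℝ≥0 → ℝ) : Prop :=
  ∃ g, IsGrowth g ∧ IsTame g ∧ 0 ≤ u 1 ∧ ∃ C : ℝ, 1 ≤ C ∧ ∀ x : ℝ≥0, 2 ≤ x →
    (g ⌊x⌋₊ : ℝ) ≤ C * u x ∧ u x ≤ C * g ⌊x⌋₊

theorem IsTame.pos {g : ℕ → ℕ} (hg : IsTame g) (h0 : g 0 = 1) (n : ℕ) : (0 : ℝ) < g n := by
  obtain ⟨C, hC, h⟩ := hg
  induction n with
  | zero => simp [h0]
  | succ n ih => exact pos_of_mul_pos_right (ih.trans_le (h n).1) (by linarith)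

/-- The value is a convex combination of two neighbouring terms; `1 ≤ x` avoids the artificial value
`0` at index `0`. -/
theorem linearInterpolation_le {a : ℕ → ℝ} {x : ℝ≥0} {B : ℝ} (hx : 1 ≤ x) (h : a ⌊x⌋₊ ≤ B)
    (h' : a (⌊x⌋₊ + 1) ≤ B) : linearInterpolation a x ≤ B := by
  have hn : ⌊x⌋₊ ≠ 0 := (Nat.floor_pos.2 hx).ne'
  have h1 : ((⌊x⌋₊ : ℕ) : ℝ) ≤ x := by exact_mod_cast Nat.floor_le (zero_le (a := x))
  have h2 : (x : ℝ) < (⌊x⌋₊ : ℕ) + 1 := by exact_mod_cast Nat.lt_floor_add_one x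
  simp only [linearInterpolation, hn, if_false, Nat.succ_ne_zero]
  nlinarith

theorem le_linearInterpolation {a : ℕ → ℝ} {x : ℝ≥0} {B : ℝ} (hx : 1 ≤ x) (h : B ≤ a ⌊x⌋₊)
    (h' : B ≤ a (⌊x⌋₊ + 1)) : B ≤ linearInterpolation a x := by
  have hn : ⌊x⌋₊ ≠ 0 := (Nat.floor_pos.2 hx).ne'
  have h1 : ((⌊x⌋₊ : ℕ) : ℝ) ≤ x := by exact_mod_cast Nat.floor_le (zero_le (a := x))
  have h2 : (x : ℝ) < (⌊x⌋₊ : ℕ) + 1 := by exact_mod_cast Nat.lt_floor_add_one x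
  simp only [linearInterpolation, hn, if_false, Nat.succ_ne_zero]
  nlinarith

theorem two_le_floor {x : ℝ≥0} (hx : 2 ≤ x) : 2 ≤ ⌊x⌋₊ :=
  Nat.le_floor (by exact_mod_cast hx)

theorem IsGrowthLike.isTheta {u : ℝ≥0 → ℝ} (hu : IsGrowthLike u) :
    ∃ M : MultiwaySystem, u =Θ[atTop] linearInterpolation (fun n => (M.growth n : ℝ)) := by
  obtain ⟨g, hg, ⟨D, hD, ht⟩, -, C, hC, h⟩ := hu
  obtain ⟨M, hM⟩ := hg.exists_system
  refine ⟨M, ?_⟩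
  simp only [hM]
  have hev : ∀ᶠ x : ℝ≥0 in atTop, 2 ≤ x := eventually_ge_atTop 2
  have hlow : ∀ x : ℝ≥0, 2 ≤ x → (g ⌊x⌋₊ : ℝ) ≤ D * linearInterpolation (fun n => (g n : ℝ)) x := by
    intro x hx
    rw [← div_le_iff₀' (by linarith)]
    refine le_linearInterpolation (one_le_two.trans hx) ?_ ?_
    · exact div_le_self (Nat.cast_nonneg _) hD
    · rw [div_le_iff₀' (by linarith)]
      exact (ht _).1
  have hup : ∀ x : ℝ≥0, 2 ≤ x → linearInterpolation (fun n => (g n : ℝ)) x ≤ D * g ⌊x⌋₊ := by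
    intro x hx
    refine linearInterpolation_le (one_le_two.trans hx) ?_ (ht _).2
    exact le_mul_of_one_le_left (Nat.cast_nonneg _) hD
  have hu0 : ∀ x : ℝ≥0, 2 ≤ x → 0 ≤ u x := fun x hx =>
    nonneg_of_mul_nonneg_right ((Nat.cast_nonneg _).trans (h x hx).1) (by linarith)
  have hl0 : ∀ x : ℝ≥0, 2 ≤ x → 0 ≤ linearInterpolation (fun n => (g n : ℝ)) x := fun x hx =>
    nonneg_of_mul_nonneg_right ((Nat.cast_nonneg _).trans (hlow x hx)) (by linarith)
  constructor
  · refine IsBigO.of_bound (C * D) (hev.mono fun x hx => ?_)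
    rw [Real.norm_of_nonneg (hu0 x hx), Real.norm_of_nonneg (hl0 x hx), mul_assoc]
    exact (h x hx).2.trans (mul_le_mul_of_nonneg_left (hlow x hx) (by linarith))
  · refine IsBigO.of_bound (D * C) (hev.mono fun x hx => ?_)
    rw [Real.norm_of_nonneg (hu0 x hx), Real.norm_of_nonneg (hl0 x hx), mul_assoc]
    exact (hup x hx).trans (mul_le_mul_of_nonneg_left (h x hx).1 (by linarith))

theorem IsGrowthLike.add {u v : ℝ≥0 → ℝ} (hu : IsGrowthLike u) (hv : IsGrowthLike v) :
    IsGrowthLike fun x => u x + v x := by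
  obtain ⟨g, hg, ⟨D, hD, htg⟩, hu1, A, hA, hgu⟩ := hu
  obtain ⟨h, hh, ⟨E, hE, hth⟩, hv1, B, hB, hhv⟩ := hv
  obtain ⟨f, hf, hfs⟩ := hg.add hh
  have hg0 : ∀ n, (0 : ℝ) ≤ g n := fun n => Nat.cast_nonneg _
  have hh0 : ∀ n, (0 : ℝ) ≤ h n := fun n => Nat.cast_nonneg _
  refine ⟨f, hf, ⟨D + E, by linarith, ?_⟩, add_nonneg hu1 hv1, (D + E) * (A + B), by nlinarith,
    fun x hx => ?_⟩
  · rintro (_ | n)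
    · rw [hfs, hf.zero, hg.zero, hh.zero]
      constructor <;> push_cast <;> linarith
    · rw [hfs, hfs]
      push_cast
      have h1 := htg n
      have h2 := hth n
      constructor <;> nlinarith [hg0 n, hh0 n, hg0 (n + 1), hh0 (n + 1)]
  · obtain ⟨m, hm⟩ : ∃ m, ⌊x⌋₊ = m + 1 := ⟨⌊x⌋₊ - 1, by have := two_le_floor hx; omega⟩
    have h1 := hgu x hx
    have h2 := hhv x hx
    rw [hm] at h1 h2 ⊢
    rw [hfs]
    push_cast
    have hux : 0 ≤ u x := nonneg_of_mul_nonneg_right ((hg0 _).trans h1.1) (by linarith)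
    have hvx : 0 ≤ v x := nonneg_of_mul_nonneg_right ((hh0 _).trans h2.1) (by linarith)
    have h3 : (g m : ℝ) ≤ D * (A * u x) :=
      (htg m).1.trans (mul_le_mul_of_nonneg_left h1.1 (by linarith))
    have h4 : (h m : ℝ) ≤ E * (B * v x) :=
      (hth m).1.trans (mul_le_mul_of_nonneg_left h2.1 (by linarith))
    have h5 : u x ≤ A * (D * g m) := h1.2.trans (mul_le_mul_of_nonneg_left (htg m).2 (by linarith))
    have h6 : v x ≤ B * (E * h m) := h2.2.trans (mul_le_mul_of_nonneg_left (hth m).2 (by linarith))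
    have hA0 : 0 ≤ A := by linarith
    have hB0 : 0 ≤ B := by linarith
    have hD0 : 0 ≤ D := by linarith
    have hE0 : 0 ≤ E := by linarith
    have hDA : D * A ≤ (D + E) * (A + B) := by gcongr <;> linarith
    have hEB : E * B ≤ (D + E) * (A + B) := by gcongr <;> linarith
    constructor
    · nlinarith [mul_le_mul_of_nonneg_right hDA hux, mul_le_mul_of_nonneg_right hEB hvx]
    · nlinarith [mul_le_mul_of_nonneg_right hDA (hg0 m), mul_le_mul_of_nonneg_right hEB (hh0 m)]

/-- Advancing `n` shifts the argument of `h` in every old term and adds the term `g (n + 1) * h 0`,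
which is at most `D` times the old term `g n * h 0`. -/
theorem IsTame.convolution {g h : ℕ → ℕ} (hg : IsTame g) (hh : IsTame h) :
    IsTame fun n => ∑ k ∈ Finset.range (n + 1), g k * h (n - k) := by
  obtain ⟨D, hD, htg⟩ := hg
  obtain ⟨E, hE, hth⟩ := hh
  refine ⟨D + E, by linarith, fun n => ?_⟩
  push_cast
  have hsub : ∀ k ∈ Finset.range (n + 1), n + 1 - k = n - k + 1 := fun k hk => by
    rw [Finset.mem_range] at hk; omega
  have h1 : ∑ k ∈ Finset.range (n + 1), (g k : ℝ) * h (n - k) ≤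
      E * ∑ k ∈ Finset.range (n + 1), (g k : ℝ) * h (n + 1 - k) := by
    rw [Finset.mul_sum]
    refine Finset.sum_le_sum fun k hk => ?_
    rw [hsub k hk, mul_left_comm]
    exact mul_le_mul_of_nonneg_left (hth _).1 (Nat.cast_nonneg _)
  have h2 : ∑ k ∈ Finset.range (n + 1), (g k : ℝ) * h (n + 1 - k) ≤
      E * ∑ k ∈ Finset.range (n + 1), (g k : ℝ) * h (n - k) := by
    rw [Finset.mul_sum]
    refine Finset.sum_le_sum fun k hk => ?_
    rw [hsub k hk, mul_left_comm]
    exact mul_le_mul_of_nonneg_left (hth _).2 (Nat.cast_nonneg _)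
  have h3 : (g n : ℝ) * h 0 ≤ ∑ k ∈ Finset.range (n + 1), (g k : ℝ) * h (n - k) := by
    have := Finset.single_le_sum (f := fun k => (g k : ℝ) * h (n - k)) (s := Finset.range (n + 1))
      (fun k _ => by positivity) (Finset.self_mem_range_succ n)
    simpa using this
  have h4 : (g (n + 1) : ℝ) * h 0 ≤ D * (g n * h 0) := by
    rw [← mul_assoc]
    exact mul_le_mul_of_nonneg_right (htg n).2 (Nat.cast_nonneg _)
  have h5 : (0 : ℝ) ≤ g (n + 1) * h 0 := by positivity
  have h6 : (0 : ℝ) ≤ ∑ k ∈ Finset.range (n + 1), (g k : ℝ) * h (n - k) :=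
    Finset.sum_nonneg fun k _ => by positivity
  have h7 : (0 : ℝ) ≤ ∑ k ∈ Finset.range (n + 1), (g k : ℝ) * h (n + 1 - k) :=
    Finset.sum_nonneg fun k _ => by positivity
  rw [Finset.sum_range_succ _ (n + 1), Nat.sub_self]
  constructor <;> nlinarith

/-- The lower bound leaves out index `1`, where `u` may vanish, as `log` does. At index `0` both
sides are `1`. -/
theorem exists_unitAtZero_bounds {u : ℝ≥0 → ℝ} {g : ℕ → ℕ} (hg : IsGrowth g) (ht : IsTame g)
    (hu1 : 0 ≤ u 1) {C : ℝ} (hC : 1 ≤ C)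
    (h : ∀ x : ℝ≥0, 2 ≤ x → (g ⌊x⌋₊ : ℝ) ≤ C * u x ∧ u x ≤ C * g ⌊x⌋₊) :
    ∃ A : ℝ, 1 ≤ A ∧ ∀ k, 0 ≤ unitAtZero u k ∧ unitAtZero u k ≤ A * g k ∧
      (k ≠ 1 → (g k : ℝ) ≤ A * unitAtZero u k) := by
  have hpos := ht.pos hg.zero
  have hq : 0 ≤ u 1 / g 1 := div_nonneg hu1 (hpos 1).le
  refine ⟨C + u 1 / g 1, by linarith, fun k => ?_⟩
  rcases k with _ | _ | k
  · simp only [unitAtZero, if_true, hg.zero]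
    norm_num
    linarith
  · simp only [unitAtZero, zero_add, one_ne_zero, if_false, Nat.cast_one, ne_eq, not_true_eq_false,
      false_imp_iff, and_true]
    refine ⟨hu1, ?_⟩
    have := div_mul_cancel₀ (u 1) (hpos 1).ne'
    nlinarith [hpos 1]
  · have hk := h ((k + 1 + 1 : ℕ) : ℝ≥0) (by push_cast; rw [add_assoc, one_add_one_eq_two]; simp)
    rw [Nat.floor_natCast] at hk
    simp only [unitAtZero, Nat.succ_ne_zero, if_false]
    have h0 : 0 ≤ u ((k + 1 + 1 : ℕ) : ℝ≥0) :=
      nonneg_of_mul_nonneg_right ((Nat.cast_nonneg _).trans hk.1) (by linarith)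
    exact ⟨h0, by nlinarith [hpos (k + 1 + 1)], fun _ => by nlinarith⟩

theorem IsGrowthLike.discreteConvolution {u v : ℝ≥0 → ℝ} (hu : IsGrowthLike u)
    (hv : IsGrowthLike v) : IsGrowthLike (discreteConvolution u v) := by
  obtain ⟨g, hg, htg, hu1, A', hA', hgu⟩ := hu
  obtain ⟨h, hh, hth, hv1, B', hB', hhv⟩ := hv
  obtain ⟨A, hA, hu⟩ := exists_unitAtZero_bounds hg htg hu1 hA' hgu
  obtain ⟨B, hB, hv⟩ := exists_unitAtZero_bounds hh hth hv1 hB' hhv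
  have htf := htg.convolution hth
  refine ⟨_, hg.convolution hh, htf, ?_, ?_⟩
  · refine le_linearInterpolation le_rfl ?_ ?_ <;>
    exact Finset.sum_nonneg fun k _ => mul_nonneg (hu k).1 (hv _).1
  set f : ℕ → ℕ := fun n => ∑ k ∈ Finset.range (n + 1), g k * h (n - k) with hf
  set s : ℕ → ℝ := fun n => ∑ k ∈ Finset.range (n + 1), unitAtZero u k * unitAtZero v (n - k)
    with hs
  have hs0 : ∀ n k, k ≤ n → unitAtZero u k * unitAtZero v (n - k) ≤ s n := fun n k hk =>
    Finset.single_le_sum (f := fun k => unitAtZero u k * unitAtZero v (n - k))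
      (fun k _ => mul_nonneg (hu k).1 (hv _).1) (Finset.mem_range.2 (by omega))
  have hsn : ∀ n, 0 ≤ s n := fun n =>
    Finset.sum_nonneg fun k _ => mul_nonneg (hu k).1 (hv _).1
  have hup : ∀ n, s n ≤ A * B * f n := by
    intro n
    simp only [hf, hs]
    push_cast
    rw [Finset.mul_sum]
    refine Finset.sum_le_sum fun k _ => ?_
    calc unitAtZero u k * unitAtZero v (n - k) ≤ (A * g k) * (B * h (n - k)) :=
          mul_le_mul (hu k).2.1 (hv _).2.1 (hv _).1 (by positivity)
      _ = A * B * (g k * h (n - k)) := by ring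
  obtain ⟨D, hD, htg⟩ := htg
  obtain ⟨E, hE, hth⟩ := hth
  obtain ⟨F, hF, htf⟩ := htf
  have hlow : ∀ n, 2 ≤ n → f n ≤ (A * B + 2 * (D * E * (A * B))) * s n := by
    intro n hn
    -- Only `k = 1` and `k = n - 1` involve a value at `1`, and there the term of `s n` may vanish.
    -- By tameness these two terms are controlled by the end terms `k = 0` and `k = n`, where one
    -- factor is `1` by convention. For `n = 2` the two cases coincide, and counting both does no
    -- harm.
    have hbound : ∀ k ∈ Finset.range (n + 1), (g k : ℝ) * h (n - k) ≤
        A * B * (unitAtZero u k * unitAtZero v (n - k)) +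
          (if k = 1 then D * E * (A * B) * s n else 0) +
          (if k = n - 1 then D * E * (A * B) * s n else 0) := by
      intro k hk
      rw [Finset.mem_range] at hk
      have hC : 0 ≤ D * E * (A * B) * s n := mul_nonneg (by positivity) (hsn n)
      have hterm : 0 ≤ A * B * (unitAtZero u k * unitAtZero v (n - k)) :=
        mul_nonneg (by positivity) (mul_nonneg (hu k).1 (hv _).1)
      have hi : ∀ p : Prop, ∀ _ : Decidable p, 0 ≤ if p then D * E * (A * B) * s n else 0 := by
        intro p _; split_ifs <;> simp [hC]
      by_cases h1 : k = 1
      · subst h1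
        have e1 : (g 1 : ℝ) ≤ D := by simpa [hg.zero] using (htg 0).2
        have e2 : (h (n - 1) : ℝ) ≤ E * (B * unitAtZero v n) := by
          have := (hth (n - 1)).1
          rw [show n - 1 + 1 = n by omega] at this
          exact this.trans (mul_le_mul_of_nonneg_left ((hv n).2.2 (by omega)) (by linarith))
        have e3 : unitAtZero v n ≤ s n := by simpa [unitAtZero] using hs0 n 0 (by omega)
        have e4 : (g 1 : ℝ) * h (n - 1) ≤ D * E * (A * B) * s n :=
          calc (g 1 : ℝ) * h (n - 1) ≤ D * (E * (B * unitAtZero v n)) :=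
                mul_le_mul e1 e2 (Nat.cast_nonneg _) (by linarith)
            _ ≤ D * (E * (B * s n)) := by gcongr
            _ = 1 * (D * E * B * s n) := by ring
            _ ≤ A * (D * E * B * s n) :=
                mul_le_mul_of_nonneg_right hA (mul_nonneg (by positivity) (hsn n))
            _ = _ := by ring
        have := hi (1 = n - 1) inferInstance
        simp only [if_true]
        linarith
      by_cases h2 : k = n - 1
      · have e1 : (h (n - k) : ℝ) ≤ E := by
          rw [show n - k = 1 by omega]; simpa [hh.zero] using (hth 0).2
        have e2 : (g k : ℝ) ≤ D * (A * unitAtZero u n) := by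
          have := (htg k).1
          rw [show k + 1 = n by omega] at this
          exact this.trans (mul_le_mul_of_nonneg_left ((hu n).2.2 (by omega)) (by linarith))
        have e3 : unitAtZero u n ≤ s n := by simpa [unitAtZero] using hs0 n n le_rfl
        have e4 : (g k : ℝ) * h (n - k) ≤ D * E * (A * B) * s n :=
          calc (g k : ℝ) * h (n - k) ≤ D * (A * unitAtZero u n) * E :=
                mul_le_mul e2 e1 (Nat.cast_nonneg _)
                  (mul_nonneg (by linarith) (mul_nonneg (by linarith) (hu n).1))
            _ ≤ D * (A * s n) * E := by gcongr
            _ = 1 * (D * E * A * s n) := by ring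
            _ ≤ B * (D * E * A * s n) :=
                mul_le_mul_of_nonneg_right hB (mul_nonneg (by positivity) (hsn n))
            _ = _ := by ring
        have := hi (k = 1) inferInstance
        rw [if_pos h2]
        linarith
      · have e : (g k : ℝ) * h (n - k) ≤ A * B * (unitAtZero u k * unitAtZero v (n - k)) :=
          calc (g k : ℝ) * h (n - k) ≤ (A * unitAtZero u k) * (B * unitAtZero v (n - k)) :=
                mul_le_mul ((hu k).2.2 h1) ((hv _).2.2 (by omega)) (Nat.cast_nonneg _)
                  (mul_nonneg (by linarith) (hu k).1)
            _ = _ := by ring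
        rw [if_neg h1, if_neg h2]
        linarith
    have := Finset.sum_le_sum hbound
    rw [Finset.sum_add_distrib, Finset.sum_add_distrib, ← Finset.mul_sum, Finset.sum_ite_eq',
      Finset.sum_ite_eq', if_pos (Finset.mem_range.2 (by omega)),
      if_pos (Finset.mem_range.2 (by omega))] at this
    simp only [hf]
    push_cast
    refine this.trans (le_of_eq ?_)
    simp only [hs]
    ring
  set K := A * B + 2 * (D * E * (A * B)) with hK
  have hAB : 1 ≤ A * B := one_le_mul_of_one_le_of_one_le hA hB
  have hABK : A * B ≤ K := by rw [hK]; nlinarith [show 0 ≤ D * E * (A * B) by positivity]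
  have hK1 : 1 ≤ K := hAB.trans hABK
  refine ⟨F * K, one_le_mul_of_one_le_of_one_le hF hK1, fun x hx => ?_⟩
  have hn := two_le_floor hx
  constructor
  · rw [← div_le_iff₀' (by positivity)]
    refine le_linearInterpolation (one_le_two.trans hx) ?_ ?_
    · rw [div_le_iff₀' (by positivity)]
      refine (hlow _ hn).trans (mul_le_mul_of_nonneg_right ?_ (hsn _))
      exact le_mul_of_one_le_left (by linarith) hF
    · rw [div_le_iff₀' (by positivity), mul_assoc]
      exact (htf _).1.trans (mul_le_mul_of_nonneg_left (hlow _ (by omega)) (by linarith))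
  · refine linearInterpolation_le (one_le_two.trans hx) ?_ ?_
    · refine (hup _).trans (mul_le_mul_of_nonneg_right ?_ (Nat.cast_nonneg _))
      exact hABK.trans (le_mul_of_one_le_left (by linarith) hF)
    · refine (hup _).trans ?_
      calc A * B * (f (⌊x⌋₊ + 1) : ℝ) ≤ K * (F * f ⌊x⌋₊) :=
            mul_le_mul hABK (htf _).2 (Nat.cast_nonneg _) (by linarith)
        _ = _ := by ring

/-! ### The basic functions -/

theorem isTame_walkClock {h : ℕ → ℕ} (h1 : ∀ k, h k ≤ h (k + 1)) {c : ℕ}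
    (h2 : ∀ k, h (k + 1) ≤ c * h k) (hc : 1 ≤ c) (d e m : ℕ) :
    IsTame fun n => h (clock d e m n).1 := by
  refine ⟨c, by exact_mod_cast hc, fun n => ?_⟩
  have key : h (clock d e m n).1 ≤ c * h (clock d e m (n + 1)).1 ∧
      h (clock d e m (n + 1)).1 ≤ c * h (clock d e m n).1 := by
    rw [clock]
    dsimp only
    split_ifs
    · exact ⟨(h1 _).trans (Nat.le_mul_of_pos_left _ hc), h2 _⟩
    · exact ⟨Nat.le_mul_of_pos_left _ hc, Nat.le_mul_of_pos_left _ hc⟩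
  exact_mod_cast key

theorem isGrowth_pow_clock {a : ℕ} (ha : 1 ≤ a) (d e m : ℕ) :
    IsGrowth fun n => a ^ (clock d e m n).1 := by
  have h := isGrowth_walkClock (fun _ _ : Fin a => True) ⟨0, ha⟩ d e m
  simpa only [ncard_walks_complete, Nat.card_eq_fintype_card, Fintype.card_fin] using h

theorem isGrowth_clock_add_one (d e m : ℕ) : IsGrowth fun n => (clock d e m n).1 + 1 := by
  have h := isGrowth_walkClock (fun q q' : Bool => q = true ∨ q' = false) true d e m
  simpa only [ncard_walks_bool] using h

theorem isTame_pow_clock {a : ℕ} (ha : 1 ≤ a) (d e m : ℕ) :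
    IsTame fun n => a ^ (clock d e m n).1 :=
  isTame_walkClock (h := fun k => a ^ k) (fun _ => Nat.pow_le_pow_right ha (Nat.le_succ _))
    (fun _ => (pow_succ' a _).le) ha d e m

theorem isTame_clock_add_one (d e m : ℕ) : IsTame fun n => (clock d e m n).1 + 1 :=
  isTame_walkClock (h := fun k => k + 1) (c := 2) (fun _ => by omega) (fun _ => by omega)
    (by norm_num) d e m

theorem tickTime_constant (k : ℕ) : tickTime 1 0 0 k = 2 * k := by
  have h : ∀ k, tapeLength 1 0 0 k = 0 := fun k => by
    induction k with
    | zero => rfl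
    | succ k ih => rw [tapeLength, ih]
  induction k with
  | zero => rfl
  | succ k ih => rw [tickTime, ih, h]; ring

theorem tickTime_linear (k : ℕ) : tickTime 1 1 0 k = k * (k + 1) := by
  have h : ∀ k, tapeLength 1 1 0 k = k := fun k => by
    induction k with
    | zero => rfl
    | succ k ih => rw [tapeLength, ih]; ring
  induction k with
  | zero => rfl
  | succ k ih => rw [tickTime, ih, h]; ring

theorem tickTime_doubling (k : ℕ) : tickTime 2 0 1 k + 2 = 2 * 2 ^ k + 2 * k := by
  have h : ∀ k, tapeLength 2 0 1 k = 2 ^ k := fun k => by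
    induction k with
    | zero => rfl
    | succ k ih => rw [tapeLength, ih]; ring
  induction k with
  | zero => rfl
  | succ k ih => rw [tickTime, h]; rw [pow_succ]; omega

theorem isGrowthLike_exponential {a : ℕ} (ha : 1 ≤ a) :
    IsGrowthLike fun x => (a : ℝ) ^ (x : ℝ) := by
  have ha' : (1 : ℝ) ≤ a := by exact_mod_cast ha
  have ha2 : 1 ≤ a ^ 2 := Nat.one_le_pow _ _ ha
  have ha2' : (1 : ℝ) ≤ (a : ℝ) ^ 2 := one_le_pow₀ ha'
  -- With an empty tape a tick takes two steps, so `a ^ 2` choices per tick give `a` per step.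
  refine ⟨_, isGrowth_pow_clock ha2 1 0 0, isTame_pow_clock ha2 1 0 0, by positivity,
    (a : ℝ) ^ 2, ha2', fun x _ => ?_⟩
  have h1 := tickTime_clock_le 1 0 0 ⌊x⌋₊
  have h2 := lt_tickTime_clock_succ 1 0 0 ⌊x⌋₊
  rw [tickTime_constant] at h1 h2
  set k := (clock 1 0 0 ⌊x⌋₊).1
  have hx1 : ((2 * k : ℕ) : ℝ) ≤ x := by exact_mod_cast (Nat.le_floor_iff (zero_le (a := x))).1 h1
  have hx2 : (x : ℝ) ≤ ((2 * (k + 1) : ℕ) : ℝ) := by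
    exact_mod_cast ((Nat.floor_lt (zero_le (a := x))).1 h2).le
  have e1 := Real.rpow_le_rpow_of_exponent_le ha' hx1
  have e2 := Real.rpow_le_rpow_of_exponent_le ha' hx2
  rw [Real.rpow_natCast] at e1 e2
  push_cast
  rw [← pow_mul, ← pow_add]
  constructor
  · exact e1.trans (le_mul_of_one_le_left (by positivity) ha2')
  · rwa [show 2 + 2 * k = 2 * (k + 1) by ring]

/-- `k ^ 2 ≤ k * (k + 1)` and `(k + 1) * (k + 2) ≤ (k + 2) ^ 2`. -/
theorem sqrt_bounds {x : ℝ≥0} {k : ℕ} (h1 : k * (k + 1) ≤ ⌊x⌋₊)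
    (h2 : ⌊x⌋₊ < (k + 1) * (k + 1 + 1)) :
    (k : ℝ) ≤ Real.sqrt x ∧ Real.sqrt x ≤ ((k + 2 : ℕ) : ℝ) := by
  have hx1 : ((k * (k + 1) : ℕ) : ℝ) ≤ x := by
    exact_mod_cast (Nat.le_floor_iff (zero_le (a := x))).1 h1
  have hx2 : (x : ℝ) ≤ (((k + 1) * (k + 1 + 1) : ℕ) : ℝ) := by
    exact_mod_cast ((Nat.floor_lt (zero_le (a := x))).1 h2).le
  push_cast at hx1 hx2 ⊢
  have hk : (0 : ℝ) ≤ k := Nat.cast_nonneg _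
  constructor
  · exact Real.le_sqrt_of_sq_le (by nlinarith)
  · exact (Real.sqrt_le_left (by linarith)).2 (by nlinarith)

theorem isGrowthLike_exponentialSqrt {a : ℕ} (ha : 1 ≤ a) :
    IsGrowthLike fun x => (a : ℝ) ^ Real.sqrt (x : ℝ) := by
  have ha' : (1 : ℝ) ≤ a := by exact_mod_cast ha
  have ha2' : (1 : ℝ) ≤ (a : ℝ) ^ 2 := one_le_pow₀ ha'
  refine ⟨_, isGrowth_pow_clock ha 1 1 0, isTame_pow_clock ha 1 1 0, by positivity,
    (a : ℝ) ^ 2, ha2', fun x _ => ?_⟩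
  have h1 := tickTime_clock_le 1 1 0 ⌊x⌋₊
  have h2 := lt_tickTime_clock_succ 1 1 0 ⌊x⌋₊
  rw [tickTime_linear] at h1 h2
  obtain ⟨hx1, hx2⟩ := sqrt_bounds h1 h2
  have e1 := Real.rpow_le_rpow_of_exponent_le ha' hx1
  have e2 := Real.rpow_le_rpow_of_exponent_le ha' hx2
  rw [Real.rpow_natCast] at e1 e2
  push_cast
  rw [← pow_add, add_comm 2]
  exact ⟨e1.trans (le_mul_of_one_le_left (by positivity) ha2'), e2⟩

theorem isGrowthLike_sqrt : IsGrowthLike fun x => Real.sqrt (x : ℝ) := by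
  refine ⟨_, isGrowth_clock_add_one 1 1 0, isTame_clock_add_one 1 1 0, Real.sqrt_nonneg _,
    2, one_le_two, fun x hx => ?_⟩
  have h1 := tickTime_clock_le 1 1 0 ⌊x⌋₊
  have h2 := lt_tickTime_clock_succ 1 1 0 ⌊x⌋₊
  rw [tickTime_linear] at h1 h2
  obtain ⟨hx1, hx2⟩ := sqrt_bounds h1 h2
  have hx' : (1 : ℝ) ≤ x := by exact_mod_cast one_le_two.trans hx
  have hs : 1 ≤ Real.sqrt x := Real.one_le_sqrt.2 hx'
  push_cast at hx2 ⊢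
  constructor <;> linarith

theorem isGrowthLike_log : IsGrowthLike fun x => Real.log (x : ℝ) := by
  refine ⟨_, isGrowth_clock_add_one 2 0 1, isTame_clock_add_one 2 0 1, by simp,
    4, by norm_num, fun x hx => ?_⟩
  have h1 := tickTime_clock_le 2 0 1 ⌊x⌋₊
  have h2 := lt_tickTime_clock_succ 2 0 1 ⌊x⌋₊
  have t1 := tickTime_doubling (clock 2 0 1 ⌊x⌋₊).1
  have t2 := tickTime_doubling ((clock 2 0 1 ⌊x⌋₊).1 + 1)
  have hn := two_le_floor hx
  set k := (clock 2 0 1 ⌊x⌋₊).1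
  have hk : k < 2 ^ k := Nat.lt_two_pow_self
  rw [pow_succ] at t2
  -- The tick times are `2 * 2 ^ k + 2 * k - 2`, which vanishes at `k = 0`; there `2 ≤ x` is used
  -- instead.
  have b1 : 2 ^ k ≤ ⌊x⌋₊ := by
    rcases Nat.eq_zero_or_pos k with h0 | h0
    · rw [h0]; omega
    · omega
  have b2 : ⌊x⌋₊ < 8 * 2 ^ k := by omega
  have hx1 : (2 : ℝ) ^ k ≤ x := by exact_mod_cast (Nat.le_floor_iff (zero_le (a := x))).1 b1
  have hx2 : (x : ℝ) ≤ 2 ^ (k + 3) := by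
    have : (x : ℝ) ≤ 8 * 2 ^ k := by exact_mod_cast ((Nat.floor_lt (zero_le (a := x))).1 b2).le
    rw [pow_add]; linarith
  have hx' : (2 : ℝ) ≤ x := by exact_mod_cast hx
  have e1 := Real.log_le_log (by positivity) hx1
  have e2 := Real.log_le_log (by linarith) hx2
  have e3 := Real.log_le_log (by norm_num) hx'
  rw [Real.log_pow] at e1 e2
  have l1 := Real.log_two_gt_d9
  have l2 := Real.log_two_lt_d9
  have hk0 : (0 : ℝ) ≤ k := Nat.cast_nonneg _
  push_cast at e2 ⊢
  constructor <;> nlinarith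

theorem isGrowth_one : IsGrowth fun _ => 1 := by
  simpa using isGrowth_pow_clock le_rfl 1 0 0

theorem isGrowthLike_const {c : ℕ} (hc : 1 ≤ c) : IsGrowthLike fun _ => (c : ℝ) := by
  have hc' : (1 : ℝ) ≤ c := by exact_mod_cast hc
  refine ⟨_, isGrowth_one, ⟨1, le_rfl, by simp⟩, by positivity, c, hc', fun x _ => ?_⟩
  constructor
  · push_cast; nlinarith
  · simp

/-- Telescoping: the increment of `n ^ (p + 1)` from `n` to `n + 1` is at most `(p + 1) * (n + 1) ^
p`. -/
theorem pow_succ_le_mul_sum (p n : ℕ) :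
    (n + 1) ^ (p + 1) ≤ (p + 1) * ∑ k ∈ Finset.range (n + 1), (k + 1) ^ p := by
  have h : ∀ p n : ℕ, (n + 1) ^ (p + 1) ≤ n ^ (p + 1) + (p + 1) * (n + 1) ^ p := by
    intro p n
    induction p with
    | zero => simp
    | succ p ih =>
      calc (n + 1) ^ (p + 1 + 1) = (n + 1) * (n + 1) ^ (p + 1) := by ring
        _ ≤ (n + 1) * (n ^ (p + 1) + (p + 1) * (n + 1) ^ p) := Nat.mul_le_mul_left _ ih
        _ = n ^ (p + 1 + 1) + n ^ (p + 1) + (p + 1) * (n + 1) ^ (p + 1) := by ring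
        _ ≤ n ^ (p + 1 + 1) + (n + 1) ^ (p + 1) + (p + 1) * (n + 1) ^ (p + 1) := by
          gcongr; omega
        _ = _ := by ring
  induction n with
  | zero => simp
  | succ n ih =>
    rw [Finset.sum_range_succ, mul_add]
    exact (h p (n + 1)).trans (Nat.add_le_add_right ih _)

/-- Convolution with the constant `1` forms partial sums, which raises the degree by one. -/
theorem exists_isGrowth_pow (p : ℕ) : ∃ g, IsGrowth g ∧ ∃ C : ℕ, 1 ≤ C ∧
    ∀ n, (n + 1) ^ p ≤ C * g n ∧ g n ≤ (n + 1) ^ p := by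
  induction p with
  | zero => exact ⟨_, isGrowth_one, 1, le_rfl, by simp⟩
  | succ p ih =>
    obtain ⟨g, hg, C, hC, h⟩ := ih
    refine ⟨_, hg.convolution isGrowth_one, (p + 1) * C, Nat.mul_pos p.succ_pos hC, fun n => ?_⟩
    simp only [mul_one]
    constructor
    · refine (pow_succ_le_mul_sum p n).trans ?_
      rw [mul_assoc, Finset.mul_sum (a := C)]
      exact Nat.mul_le_mul_left _ (Finset.sum_le_sum fun k _ => (h k).1)
    · calc ∑ k ∈ Finset.range (n + 1), g k ≤ ∑ k ∈ Finset.range (n + 1), (n + 1) ^ p := by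
            refine Finset.sum_le_sum fun k hk => (h k).2.trans (Nat.pow_le_pow_left ?_ _)
            rw [Finset.mem_range] at hk
            omega
        _ = (n + 1) ^ (p + 1) := by simp [pow_succ']

theorem isGrowthLike_pow (p : ℕ) : IsGrowthLike fun x => (x : ℝ) ^ p := by
  obtain ⟨g, hg, C, hC, h⟩ := exists_isGrowth_pow p
  have h' : ∀ n : ℕ, ((n : ℝ) + 1) ^ p ≤ C * g n ∧ (g n : ℝ) ≤ ((n : ℝ) + 1) ^ p := fun n => by
    exact_mod_cast h n
  have hC' : (1 : ℝ) ≤ C := by exact_mod_cast hC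
  have h2 : (1 : ℝ) ≤ 2 ^ p := one_le_pow₀ one_le_two
  have hD : (1 : ℝ) ≤ 2 ^ p * C := one_le_mul_of_one_le_of_one_le h2 hC'
  refine ⟨g, hg, ⟨2 ^ p * C, hD, fun n => ?_⟩, by positivity, 2 ^ p * C, hD, fun x hx => ?_⟩
  · have h3 := h' (n + 1)
    push_cast at h3
    constructor
    · calc (g n : ℝ) ≤ ((n : ℝ) + 1) ^ p := (h' n).2
        _ ≤ ((n : ℝ) + 1 + 1) ^ p := by gcongr; linarith
        _ ≤ 1 * (C * g (n + 1)) := by rw [one_mul]; exact h3.1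
        _ ≤ 2 ^ p * (C * g (n + 1)) := by gcongr
        _ = _ := by ring
    · calc (g (n + 1) : ℝ) ≤ ((n : ℝ) + 1 + 1) ^ p := h3.2
        _ ≤ (2 * ((n : ℝ) + 1)) ^ p := by gcongr; linarith [(Nat.cast_nonneg n : (0 : ℝ) ≤ n)]
        _ = 2 ^ p * ((n : ℝ) + 1) ^ p := mul_pow _ _ _
        _ ≤ 2 ^ p * (C * g n) := by gcongr; exact (h' n).1
        _ = _ := by ring
  · have h1 : ((⌊x⌋₊ : ℕ) : ℝ) ≤ x := by exact_mod_cast Nat.floor_le (zero_le (a := x))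
    have h2 : (x : ℝ) < (⌊x⌋₊ : ℕ) + 1 := by exact_mod_cast Nat.lt_floor_add_one x
    have hx' : (2 : ℝ) ≤ x := by exact_mod_cast hx
    have h3 := h' ⌊x⌋₊
    constructor
    · calc (g ⌊x⌋₊ : ℝ) ≤ ((⌊x⌋₊ : ℕ) + 1 : ℝ) ^ p := h3.2
        _ ≤ (2 * x : ℝ) ^ p := by gcongr; linarith
        _ = 2 ^ p * 1 * (x : ℝ) ^ p := by rw [mul_pow, mul_one]
        _ ≤ 2 ^ p * C * (x : ℝ) ^ p := by gcongr
    · calc (x : ℝ) ^ p ≤ ((⌊x⌋₊ : ℕ) + 1 : ℝ) ^ p := by gcongr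
        _ ≤ 1 * (C * g ⌊x⌋₊) := by rw [one_mul]; exact h3.1
        _ ≤ 2 ^ p * (C * g ⌊x⌋₊) := by gcongr
        _ = _ := by ring

theorem isGrowthLike_of_isFiniteCombination {u : ℝ≥0 → ℝ} (hu : IsFiniteCombination u) :
    IsGrowthLike u := by
  induction hu with
  | const c hc => exact isGrowthLike_const hc
  | power n _ => exact isGrowthLike_pow n
  | exponential a ha => exact isGrowthLike_exponential ha
  | exponentialSqrt a ha => exact isGrowthLike_exponentialSqrt ha
  | squareRoot => exact isGrowthLike_sqrt
  | logarithm => exact isGrowthLike_log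
  | add _ _ hu hv => exact hu.add hv
  | convolution _ _ hu hv => exact hu.discreteConvolution hv

end StringRewriting

theorem mainTheorem6 (f : ℝ≥0 → ℝ≥0)
    (hf : ∃ g : ℝ≥0 → ℝ, IsFiniteCombination g ∧ g =Θ[atTop] fun x => (f x : ℝ)) :
    MultiwayGrowthApproximable f := by
  obtain ⟨g, hg, hgf⟩ := hf
  obtain ⟨M, hM⟩ := (StringRewriting.isGrowthLike_of_isFiniteCombination hg).isTheta
  exact ⟨M, hgf.symm.trans hM⟩
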